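/- A simplicial complex $X$ is a collection of nonempty finite sets (its simplices), closed under passing to nonempty subsets; its vertices are the elements of its simplices, a $p$-simplex is a simplex with $p+1$ vertices, and the link of a simplex $\sigma$ is the complex of all simplices $\tau$ of $X$ disjoint from $\sigma$ with $\sigma\cup\tau$ a simplex of $X$. A complex is called $k$-connected ($k\in\mathbb Z$) if its geometric realization (with the weak topology) is, that is, if every continuous map $S^{i}\to |X|$ with $-1\le i\le k$ extends to a continuous map $D^{i+1}\to |X|$; so $(-1)$-connected means nonempty, and $k$-connected for $k\le -2$ is no condition. For $n\in\mathbb Z$, $X$ is weakly Cohen–Macaulay (wCM) of dimension $n$ if $X$ is $(n-1)$-connected and, for every $p\ge 0$, the link of every $p$-simplex of $X$ is $(n-p-2)$-connected. For an integer $m\ge 1$ let $X_m$ be the poset, ordered by inclusion, of the simplices of $X$ with at least $m$ vertices, viewed as a simplicial complex: its vertices are the simplices of $X$ with at least $m$ vertices, and its simplices are the nonempty finite chains of such. **Lemma.** Let $n\in\mathbb Z$, let $m\ge 1$ be an integer, and let $X$ be a simplicial complex that is wCM of dimension $n$. Then $X_m$ is wCM of dimension $n-m+1$. -/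

import Mathlib

/-! Simplicial complexes are Mathlib's `PreAbstractSimplicialComplex V`: a set of nonempty finite
subsets of `V` (the simplices) closed under passing to nonempty subsets. The vertex set is the set
of those `v : V` for which `{v}` is a simplex; it need not be all of `V`, so that links and
subcomplexes live on the same ambient type. -/

namespace WCM

/-- The (set underlying the) geometric realization `|K|`: formal convex combinations of vertices
of `K` whose support is a simplex, written in barycentric coordinates. -/
def Realization {V : Type*} (K : PreAbstractSimplicialComplex V) : Type _ :=
  {x : V →₀ ℝ // x.support ∈ K.faces ∧ (∀ v, 0 ≤ x v) ∧ x.sum (fun _ a => a) = 1}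

/-- The closed simplex of `|K|` spanned by the finite set `s`. -/
def ClosedSimplex {V : Type*} (K : PreAbstractSimplicialComplex V) (s : Finset V) : Type _ :=
  {x : Realization K // x.1.support ⊆ s}

/-- The inclusion of a closed simplex into `|K|`. -/
def ClosedSimplex.incl {V : Type*} (K : PreAbstractSimplicialComplex V) (s : Finset V) :
    ClosedSimplex K s → Realization K :=
  Subtype.val

/-- The Euclidean topology on a closed simplex: the topology of coordinatewise convergence of
barycentric coordinates (all but the finitely many coordinates in `s` vanish). -/
instance closedSimplexTopology {V : Type*} (K : PreAbstractSimplicialComplex V) (s : Finset V) :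
    TopologicalSpace (ClosedSimplex K s) :=
  TopologicalSpace.induced (fun (x : ClosedSimplex K s) (v : V) => x.1.1 v)
    (inferInstance : TopologicalSpace (V → ℝ))

/-- The weak (coherent, CW) topology on `|K|`: a set is open iff its trace on every closed simplex
of `K` is open in the Euclidean topology of that simplex. -/
instance realizationTopology {V : Type*} (K : PreAbstractSimplicialComplex V) :
    TopologicalSpace (Realization K) :=
  ⨆ s : K.faces, TopologicalSpace.coinduced (ClosedSimplex.incl K s.1) inferInstance

/-- `X` is `k`-connected (`k` an integer): every continuous map `S^{j-1} → X` with
`-1 ≤ j - 1 ≤ k` extends continuously to the disc `D^j`. For `j = 0` the sphere is empty and the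
disc is a point, so `(-1)`-connected means nonempty, and every space is `k`-connected for
`k ≤ -2`. -/
def IsConnectedTo (k : ℤ) (X : Type*) [TopologicalSpace X] : Prop :=
  ∀ j : ℕ, (j : ℤ) ≤ k + 1 →
    ∀ f : C(Metric.sphere (0 : EuclideanSpace ℝ (Fin j)) 1, X),
      ∃ g : C(Metric.closedBall (0 : EuclideanSpace ℝ (Fin j)) 1, X),
        ∀ x : Metric.sphere (0 : EuclideanSpace ℝ (Fin j)) 1,
          g ⟨x.1, Metric.sphere_subset_closedBall x.2⟩ = f x

open Classical in
/-- The link of `s` in `K`: the simplices disjoint from `s` whose union with `s` is a simplex. -/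
def link {V : Type*} (K : PreAbstractSimplicialComplex V) (s : Finset V) :
    PreAbstractSimplicialComplex V where
  faces := {t | t.Nonempty ∧ Disjoint s t ∧ s ∪ t ∈ K.faces}
  isRelLowerSet_faces := by
    rintro t ⟨ht, hd, hu⟩
    refine ⟨ht, fun u hut hu' => ⟨hu', hd.mono_right hut, ?_⟩⟩
    exact (K.isRelLowerSet_faces hu).2 (Finset.union_subset_union_right hut)
      (hu'.mono Finset.subset_union_right)

/-- `K` is weakly Cohen-Macaulay of dimension `n`: it is `(n-1)`-connected and the link of every
`p`-simplex (a simplex with `p + 1` vertices) is `(n-p-2)`-connected. -/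
def IsWCM {V : Type*} (K : PreAbstractSimplicialComplex V) (n : ℤ) : Prop :=
  IsConnectedTo (n - 1) (Realization K) ∧
    ∀ p : ℕ, ∀ s ∈ K.faces, s.card = p + 1 →
      IsConnectedTo (n - p - 2) (Realization (link K s))

/-- The simplicial complex of nonempty finite chains of a subset `S` of a poset. -/
def chainComplex {P : Type*} [PartialOrder P] (S : Set P) : PreAbstractSimplicialComplex P where
  faces := {c | c.Nonempty ∧ (c : Set P) ⊆ S ∧ IsChain (· ≤ ·) (c : Set P)}
  isRelLowerSet_faces := by
    rintro c ⟨hc, hS, hch⟩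
    exact ⟨hc, fun d hdc hd => ⟨hd, (Finset.coe_subset.2 hdc).trans hS,
      hch.mono (Finset.coe_subset.2 hdc)⟩⟩

/-- `X_m`: the poset, under inclusion, of the simplices of `K` with at least `m` vertices, viewed
as the simplicial complex of its chains. -/
def simplicesAtLeast {V : Type*} (K : PreAbstractSimplicialComplex V) (m : ℕ) :
    PreAbstractSimplicialComplex (Finset V) :=
  chainComplex {s : Finset V | s ∈ K.faces ∧ m ≤ s.card}

end WCM

/-! The poset of all simplices of `X` is its barycentric subdivision, hence (n-1)-connected. Passing
from X_m to X_{m+1} deletes the simplices with exactly m vertices. They are pairwise incomparable,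
and the link of such an s in X_m is the poset of simplices properly containing s. This poset
subdivides the link of s in `X`, so it is (n-m-1)-connected. Deleting pairwise non-adjacent vertices
with k-connected links preserves k-connectedness (`conn_deletion`), so X_{m+1} is (n-m-1)-connected.

The link in X_m of a chain s_0 < ... < s_p is the join of three kinds of pieces: the proper subsets
of s_0 with at least m elements, the open intervals (s_i, s_{i+1}), and the simplices above s_p. The
last piece is (n-|s_p|-1)-connected. Each interval raises this by |s_{i+1}|-|s_i|-1 and the bottom
piece by |s_0|-m, which gives n-m-p-1 in total. Joins enter only as order complexes of unions Z ∪ Y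
with Z below Y. The lower factor is assembled by adding and deleting antichains
(`conn_openInterval_union`, `conn_truncated_union`), using `conn_deletion` and its converse
`conn_of_deletion`.

The topological core is `exists_push`: a map of a finely divided cubical complex is moved off the
unwanted vertices, by radial projection where their weight is small and by filling cells inside
their links elsewhere. All of this is done with coordinatewise continuous, finitely supported maps
of cubes; `isConnectedTo_iff_conn` shows that nothing is lost. -/

namespace WCM

open Set Topology

/-! ### Realizations in barycentric coordinates -/

/-- The points of `|K|`, as families of barycentric coordinates. -/
def points {V : Type*} (K : PreAbstractSimplicialComplex V) : Set (V → ℝ) :=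
  {y | (∀ v, 0 ≤ y v) ∧ ∃ t ∈ K.faces, (∀ v, v ∉ t → y v = 0) ∧ ∑ v ∈ t, y v = 1}

/-- A family of barycentric coordinates on `D`, each continuous and all but finitely many zero,
whose value at `x` lies in `Y x`. -/
def FinMap {E V : Type*} [TopologicalSpace E] (D : Set E) (Y : E → Set (V → ℝ))
    (F : E → V → ℝ) : Prop :=
  (∀ v, ContinuousOn (fun x => F x v) D) ∧ (∃ s : Finset V, ∀ x ∈ D, ∀ v, v ∉ s → F x v = 0) ∧
    ∀ x ∈ D, F x ∈ Y x

/-- The unit cube. -/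
def cube (ι : Type*) : Set (ι → ℝ) := {x | ∀ i, x i ∈ Icc (0 : ℝ) 1}

/-- The boundary of the unit cube. -/
def cubeBd (ι : Type*) : Set (ι → ℝ) := {x | x ∈ cube ι ∧ ∃ i, x i = 0 ∨ x i = 1}

/-- Every finitely supported map from the boundary of the `i`-cube to `|K|` extends to the cube. -/
def FillsCube {V : Type*} (i : ℕ) (K : PreAbstractSimplicialComplex V) : Prop :=
  ∀ g : (Fin i → ℝ) → V → ℝ, FinMap (cubeBd (Fin i)) (fun _ => points K) g →
    ∃ g', FinMap (cube (Fin i)) (fun _ => points K) g' ∧ EqOn g' g (cubeBd (Fin i))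

/-- Connectivity in terms of finitely supported maps of cubes. -/
def Conn {V : Type*} (k : ℤ) (K : PreAbstractSimplicialComplex V) : Prop :=
  ∀ i : ℕ, (i : ℤ) ≤ k + 1 → FillsCube i K

section

variable {V : Type*} {K : PreAbstractSimplicialComplex V}

theorem Conn.mono {k l : ℤ} (h : Conn k K) (hl : l ≤ k) : Conn l K :=
  fun i hi => h i (by omega)

theorem cubeBd_subset_cube (ι : Type*) : cubeBd ι ⊆ cube ι := fun _ h => h.1

theorem face_nonempty {t : Finset V} (h : t ∈ K.faces) : t.Nonempty := (K.isRelLowerSet_faces h).1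

theorem face_mono {t u : Finset V} (h : t ∈ K.faces) (hu : u ⊆ t) (hn : u.Nonempty) :
    u ∈ K.faces := (K.isRelLowerSet_faces h).2 hu hn

theorem points_sum_eq_one {y : V → ℝ} (hy : y ∈ points K) {s : Finset V}
    (hs : ∀ v, v ∉ s → y v = 0) : ∑ v ∈ s, y v = 1 := by
  classical
  obtain ⟨-, t, -, ht0, ht⟩ := hy
  rw [← ht, Finset.sum_subset (Finset.subset_union_left (s₁ := s) (s₂ := t))
    (fun v _ h => hs v h), Finset.sum_subset (Finset.subset_union_right (s₁ := s) (s₂ := t))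
    (fun v _ h => ht0 v h)]

theorem face_of_points {y : V → ℝ} (hy : y ∈ points K) {u : Finset V} (hu : ∀ v ∈ u, y v ≠ 0)
    (hn : u.Nonempty) : u ∈ K.faces := by
  obtain ⟨-, t, ht, ht0, -⟩ := hy
  exact face_mono ht (fun v hv => by_contra fun h => hu v hv (ht0 v h)) hn

theorem points_support_nonempty {y : V → ℝ} (hy : y ∈ points K) : ∃ v, y v ≠ 0 := by
  obtain ⟨-, t, -, -, h1⟩ := hy
  by_contra! h
  simp [h] at h1

/-! ### Continuity in the weak topology. -/

/-- The weak topology tests continuity on one closed simplex at a time, where the sum is finite; the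
weights may therefore be unbounded, which `exists_finset_support` exploits. -/
theorem continuous_weightedSum (a : V → ℝ) :
    Continuous (fun x : Realization K => x.1.sum fun v c => a v * c) := by
  refine continuous_iSup_dom.2 fun s => continuous_coinduced_dom.2 ?_
  have h : ((fun x : Realization K => x.1.sum fun v c => a v * c) ∘ ClosedSimplex.incl K s.1) =
      (fun y : V → ℝ => ∑ v ∈ s.1, a v * y v) ∘
        (fun (x : ClosedSimplex K s.1) (v : V) => x.1.1 v) := by
    funext x
    exact Finsupp.sum_of_support_subset _ x.2 _ (by simp)
  rw [h]
  exact (by fun_prop : Continuous fun y : V → ℝ => ∑ v ∈ s.1, a v * y v).comp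
    continuous_induced_dom

theorem continuous_coord (v : V) : Continuous (fun x : Realization K => x.1 v) := by
  classical
  convert continuous_weightedSum (K := K) (fun w => if w = v then 1 else 0) using 2 with x
  rw [Finsupp.sum]
  by_cases h : v ∈ x.1.support
  · simp [Finset.sum_ite_eq', ite_mul, h]
  · rw [Finsupp.notMem_support_iff.1 h, eq_comm]
    refine Finset.sum_eq_zero fun w hw => ?_
    rw [if_neg (by rintro rfl; exact h hw), zero_mul]

theorem exists_finset_support {E : Type*} [TopologicalSpace E] [CompactSpace E]
    {F : E → Realization K} (hF : Continuous F) :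
    ∃ s : Finset V, ∀ x v, v ∉ s → (F x).1 v = 0 := by
  classical
  by_contra! h
  have hinf : {v | ∃ x, (F x).1 v ≠ 0}.Infinite := by
    intro hfin
    obtain ⟨x, v, hv, hx⟩ := h hfin.toFinset
    exact hv (by simpa using ⟨x, hx⟩)
  let e := hinf.natEmbedding
  choose x hx using fun n => (e n).2
  have einj : Function.Injective fun n => (e n).1 := fun a b hab => e.injective (Subtype.ext hab)
  -- If infinitely many vertices `e n` occur, these weights make the weighted sum at least n at `x
  -- n`, although it is continuous on a compact space.
  let a : V → ℝ := Function.extend (fun n => (e n).1) (fun n => n / (F (x n)).1 (e n).1) 0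
  have ha : ∀ n, a (e n).1 = n / (F (x n)).1 (e n).1 := fun n => einj.extend_apply _ _ n
  have ha0 : ∀ v, 0 ≤ a v := by
    intro v
    by_cases hv : ∃ n, (e n).1 = v
    · obtain ⟨n, rfl⟩ := hv
      rw [ha]
      exact div_nonneg (Nat.cast_nonneg _) ((F (x n)).2.2.1 _)
    · exact ((Function.extend_apply' _ _ _ hv).trans (Pi.zero_apply _)).ge
  obtain ⟨B, hB⟩ := (isCompact_range ((continuous_weightedSum a).comp hF)).bddAbove
  obtain ⟨n, hn⟩ := exists_nat_gt B
  have h1 := hB (mem_range_self (x n))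
  simp only [Function.comp, Finsupp.sum] at h1
  have h2 := Finset.single_le_sum (f := fun v => a v * (F (x n)).1 v)
    (fun v _ => mul_nonneg (ha0 v) ((F (x n)).2.2.1 v)) (Finsupp.mem_support_iff.2 (hx n))
  simp only [ha, div_mul_cancel₀ _ (hx n)] at h2
  linarith

theorem continuous_of_coord {E : Type*} [TopologicalSpace E] {F : E → Realization K}
    (hF : ∀ v, Continuous fun x => (F x).1 v) {s : Finset V}
    (hs : ∀ x v, v ∉ s → (F x).1 v = 0) : Continuous F := by
  classical
  -- The source is a finite union of closed sets, on each of which the map factors through a single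
  -- closed simplex, where coordinatewise continuity suffices.
  let A : {t // t ∈ s.powerset ∧ t ∈ K.faces} → Set E := fun t => {x | (F x).1.support ⊆ t.1}
  have : Finite {t // t ∈ s.powerset ∧ t ∈ K.faces} :=
    Finite.of_injective (β := s.powerset) (fun t => ⟨t.1, t.2.1⟩)
      (fun a b h => Subtype.ext (by simpa using h))
  refine LocallyFinite.continuous (f := A) (locallyFinite_of_finite A) ?_ ?_ ?_
  · refine eq_univ_of_forall fun x => mem_iUnion.2 ⟨⟨(F x).1.support, ?_, (F x).2.1⟩, ?_⟩
    · refine Finset.mem_powerset.2 fun v hv => by_contra fun h => ?_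
      exact Finsupp.mem_support_iff.1 hv (hs x v h)
    · exact Finset.Subset.refl _
  · intro t
    have : A t = ⋂ v ∈ {v | v ∉ t.1}, {x | (F x).1 v = 0} := by
      ext x
      simp only [A, mem_ofPred_eq, mem_iInter, Finset.subset_iff, Finsupp.mem_support_iff]
      exact ⟨fun h v hv => by_contra fun h' => hv (h h'),
        fun h v hv => by_contra fun h' => hv (h v h')⟩
    rw [this]
    exact isClosed_biInter fun v _ => isClosed_eq (hF v) continuous_const
  · intro t
    rw [continuousOn_iff_continuous_domRestrict]
    let G : A t → ClosedSimplex K t.1 := fun x => ⟨F x.1, x.2⟩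
    have hG : Continuous G := continuous_induced_rng.2
      (continuous_pi fun v => (hF v).comp continuous_subtype_val)
    have hi : Continuous (ClosedSimplex.incl K t.1) :=
      continuous_iSup_rng (i := (⟨t.1, t.2.2⟩ : K.faces)) continuous_coinduced_rng
    exact hi.comp hG

/-- The point of `|K|` with given coordinates. -/
noncomputable def toRealization (y : V → ℝ) (hy : y ∈ points K) : Realization K :=
  ⟨Finsupp.ofSupportFinite y (by
      obtain ⟨-, t, -, ht0, -⟩ := hy
      exact t.finite_toSet.subset fun v hv => by_contra fun h => hv (ht0 v h)), by
    refine ⟨face_of_points hy (fun v hv => Finsupp.mem_support_iff.1 hv) ?_, hy.1, ?_⟩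
    · obtain ⟨v, hv⟩ := points_support_nonempty hy
      exact ⟨v, Finsupp.mem_support_iff.2 hv⟩
    · exact points_sum_eq_one hy fun v hv => Finsupp.notMem_support_iff.1 hv⟩

theorem toRealization_apply (y : V → ℝ) (hy : y ∈ points K) (v : V) :
    (toRealization y hy).1 v = y v := rfl

theorem coe_mem_points (x : Realization K) : (x.1 : V → ℝ) ∈ points K :=
  ⟨x.2.2.1, x.1.support, x.2.1, fun _ hv => Finsupp.notMem_support_iff.1 hv, x.2.2.2⟩

/-! ### Cubes in place of discs. -/

theorem isClosed_cube (ι : Type*) : IsClosed (cube ι) := by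
  simp only [cube, ofPred_forall]
  exact isClosed_iInter fun i => isClosed_Icc.preimage (continuous_apply i)

theorem cube_eq_pi (ι : Type*) : cube ι = univ.pi fun _ => Icc (0 : ℝ) 1 := by
  ext x; simp only [cube, mem_ofPred_eq, mem_pi, mem_univ, true_implies]

theorem isCompact_cube (ι : Type*) : IsCompact (cube ι) := by
  rw [cube_eq_pi]; exact isCompact_univ_pi fun _ => isCompact_Icc

theorem frontier_cube (ι : Type*) [Finite ι] : frontier (cube ι) = cubeBd ι := by
  rw [frontier, (isClosed_cube ι).closure_eq, cube_eq_pi, interior_pi_set finite_univ]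
  ext x
  simp only [interior_Icc, mem_sdiff, mem_pi, mem_univ, true_implies, cubeBd, cube,
    mem_ofPred_eq, mem_Ioo, mem_Icc, not_forall]
  refine and_congr_right fun h => exists_congr fun i => ?_
  have := h i
  constructor
  · intro h1
    by_contra! h2
    exact h1 ⟨lt_of_le_of_ne this.1 (Ne.symm h2.1), lt_of_le_of_ne this.2 h2.2⟩
  · rintro (h1 | h1) h2 <;> linarith [h2.1, h2.2]

theorem isClosed_cubeBd (ι : Type*) [Finite ι] : IsClosed (cubeBd ι) := by
  rw [← frontier_cube]; exact isClosed_frontier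

theorem isCompact_cubeBd (ι : Type*) [Finite ι] : IsCompact (cubeBd ι) :=
  (isCompact_cube ι).of_isClosed_subset (isClosed_cubeBd ι) (cubeBd_subset_cube ι)

/-- Both the cube and the Euclidean ball are bounded closed convex sets with nonempty interior, so a
homeomorphism of the ambient space matches them together with their frontiers. -/
theorem exists_homeomorph_cube (i : ℕ) : ∃ e : EuclideanSpace ℝ (Fin i) ≃ₜ (Fin i → ℝ),
    (∀ x, e x ∈ cube (Fin i) ↔ x ∈ Metric.closedBall 0 1) ∧
      ∀ x, e x ∈ cubeBd (Fin i) ↔ x ∈ Metric.sphere 0 1 := by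
  have hconv : Convex ℝ (cube (Fin i)) := by
    rw [cube_eq_pi]; exact convex_pi fun _ _ => convex_Icc 0 1
  have hint : (interior (cube (Fin i))).Nonempty := by
    rw [cube_eq_pi, interior_pi_set finite_univ]
    exact ⟨fun _ => 1 / 2, fun _ _ => by rw [interior_Icc]; constructor <;> norm_num⟩
  let L := EuclideanSpace.equiv (Fin i) ℝ
  let t := L.symm ⁻¹' Metric.closedBall (0 : EuclideanSpace ℝ (Fin i)) 1
  have ht : IsClosed t := Metric.isClosed_closedBall.preimage L.symm.continuous
  have htc : IsCompact t := L.symm.toHomeomorph.isCompact_preimage.2 (isCompact_closedBall _ _)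
  have hti : (interior t).Nonempty := by
    refine ⟨0, mem_interior.2 ⟨L.symm ⁻¹' Metric.ball 0 1, preimage_mono Metric.ball_subset_closedBall,
      Metric.isOpen_ball.preimage L.symm.continuous, by simp⟩⟩
  obtain ⟨e, -, h1, h2⟩ := exists_homeomorph_image_eq (s := t) (t := cube (Fin i))
    ((convex_closedBall _ _).linear_preimage L.symm.toLinearMap) hti
    (NormedSpace.isVonNBounded_of_isBounded _ htc.isBounded) hconv hint
    (NormedSpace.isVonNBounded_of_isBounded _ (isCompact_cube _).isBounded)
  rw [ht.closure_eq, (isClosed_cube _).closure_eq] at h1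
  have hf : frontier t = L.symm ⁻¹' Metric.sphere (0 : EuclideanSpace ℝ (Fin i)) 1 := by
    rw [← frontier_closedBall _ one_ne_zero]
    exact (L.symm.toHomeomorph.preimage_frontier _).symm
  rw [frontier_cube, hf] at h2
  refine ⟨L.toHomeomorph.trans e, fun x => ?_, fun x => ?_⟩
  · rw [← h1]
    exact e.injective.mem_set_image.trans (by simp [t])
  · rw [← h2]
    exact e.injective.mem_set_image.trans (by simp)

theorem continuousOn_of_restrict {E F : Type*} [TopologicalSpace E] [TopologicalSpace F]
    {D : Set E} {f : E → F} {g : D → F} (hg : Continuous g) (h : ∀ x : D, f x.1 = g x) :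
    ContinuousOn f D := by
  rw [continuousOn_iff_continuous_domRestrict]
  exact hg.congr fun x => (h x).symm

open Classical in
theorem FillsCube_iff {i : ℕ} : FillsCube i K ↔
    ∀ f : C(Metric.sphere (0 : EuclideanSpace ℝ (Fin i)) 1, Realization K),
      ∃ g : C(Metric.closedBall (0 : EuclideanSpace ℝ (Fin i)) 1, Realization K),
        ∀ x : Metric.sphere (0 : EuclideanSpace ℝ (Fin i)) 1,
          g ⟨x.1, Metric.sphere_subset_closedBall x.2⟩ = f x := by
  obtain ⟨e, he, he'⟩ := exists_homeomorph_cube i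
  have hs : ∀ y, e.symm y ∈ Metric.sphere 0 1 ↔ y ∈ cubeBd (Fin i) := fun y => by
    rw [← he', e.apply_symm_apply]
  have hc : ∀ y, e.symm y ∈ Metric.closedBall 0 1 ↔ y ∈ cube (Fin i) := fun y => by
    rw [← he, e.apply_symm_apply]
  constructor
  · intro h f
    have : CompactSpace (Metric.sphere (0 : EuclideanSpace ℝ (Fin i)) 1) :=
      isCompact_iff_compactSpace.1 (isCompact_sphere _ _)
    obtain ⟨s, hfs⟩ := exists_finset_support f.continuous
    let g : (Fin i → ℝ) → V → ℝ := fun y =>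
      if hy : y ∈ cubeBd (Fin i) then (f ⟨e.symm y, (hs y).2 hy⟩).1 else 0
    have hg : ∀ y (hy : y ∈ cubeBd (Fin i)), g y = (f ⟨e.symm y, (hs y).2 hy⟩).1 :=
      fun y hy => dif_pos hy
    have hmap : FinMap (cubeBd (Fin i)) (fun _ => points K) g := by
      refine ⟨fun v => ?_, ⟨s, fun y hy v hv => ?_⟩, fun y hy => ?_⟩
      · exact continuousOn_of_restrict
          (g := fun y : cubeBd (Fin i) => (f ⟨e.symm y.1, (hs y.1).2 y.2⟩).1 v)
          ((continuous_coord v).comp (f.continuous.comp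
            ((e.symm.continuous.comp continuous_subtype_val).subtype_mk _)))
          fun y => by simp only [hg y.1 y.2]
      · simp only [hg y hy]; exact hfs _ v hv
      · simp only [hg y hy]; exact coe_mem_points _
    obtain ⟨g', ⟨hg1, ⟨s', hg2⟩, hg3⟩, hgg⟩ := h g hmap
    let G : Metric.closedBall (0 : EuclideanSpace ℝ (Fin i)) 1 → Realization K := fun x =>
      toRealization (g' (e x.1)) (hg3 _ ((he _).2 x.2))
    refine ⟨⟨G, continuous_of_coord (s := s') (fun v => ?_) fun x v hv => ?_⟩, fun x => ?_⟩
    · exact (hg1 v).comp_continuous (e.continuous.comp continuous_subtype_val)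
        fun x => (he _).2 x.2
    · exact hg2 _ ((he _).2 x.2) v hv
    · refine Subtype.ext (DFunLike.coe_injective ?_)
      have := (hgg ((he' x.1).2 x.2)).trans (hg _ ((he' x.1).2 x.2))
      simp only [e.symm_apply_apply] at this
      exact this
  · rintro h g ⟨hg1, ⟨s, hg2⟩, hg3⟩
    let f : Metric.sphere (0 : EuclideanSpace ℝ (Fin i)) 1 → Realization K := fun x =>
      toRealization (g (e x.1)) (hg3 _ ((he' _).2 x.2))
    obtain ⟨G, hG⟩ := h ⟨f, continuous_of_coord (s := s)
      (fun v => (hg1 v).comp_continuous (e.continuous.comp continuous_subtype_val)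
          fun x => (he' _).2 x.2) fun x v hv => hg2 _ ((he' _).2 x.2) v hv⟩
    have : CompactSpace (Metric.closedBall (0 : EuclideanSpace ℝ (Fin i)) 1) :=
      isCompact_iff_compactSpace.1 (isCompact_closedBall _ _)
    obtain ⟨s', hGs⟩ := exists_finset_support G.continuous
    let g' : (Fin i → ℝ) → V → ℝ := fun y =>
      if hy : y ∈ cube (Fin i) then (G ⟨e.symm y, (hc y).2 hy⟩).1 else 0
    have hg' : ∀ y (hy : y ∈ cube (Fin i)), g' y = (G ⟨e.symm y, (hc y).2 hy⟩).1 :=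
      fun y hy => dif_pos hy
    refine ⟨g', ⟨fun v => ?_, ⟨s', fun y hy v hv => ?_⟩, fun y hy => ?_⟩, fun y hy => ?_⟩
    · exact continuousOn_of_restrict
        (g := fun y : cube (Fin i) => (G ⟨e.symm y.1, (hc y.1).2 y.2⟩).1 v)
        ((continuous_coord v).comp (G.continuous.comp
          ((e.symm.continuous.comp continuous_subtype_val).subtype_mk _)))
        fun y => by simp only [hg' y.1 y.2]
    · simp only [hg' y hy]; exact hGs _ v hv
    · simp only [hg' y hy]; exact coe_mem_points _
    · rw [hg' y hy.1, hG ⟨e.symm y, (hs y).2 hy⟩]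
      funext v
      simp [f, toRealization_apply]

theorem isConnectedTo_iff_conn {k : ℤ} : IsConnectedTo k (Realization K) ↔ Conn k K :=
  forall₂_congr fun _ _ => FillsCube_iff.symm

end

/-! ### Extending maps over the cells of a cubical grid

A cell of the grid of mesh `1 / N` in `Fin j → ℝ` is recorded by a vector of integers, an even
entry `2 * a` standing for the coordinate `a / N` and an odd entry `2 * a + 1` for the interval
`[a / N, (a + 1) / N]`. -/

section

variable {j : ℕ}

/-- The closed cell `c` of the grid of mesh `1 / N`. -/
def cellSet (N : ℕ) (c : Fin j → ℤ) : Set (Fin j → ℝ) :=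
  {x | ∀ i, ((c i / 2 : ℤ) : ℝ) ≤ N * x i ∧ N * x i ≤ (((c i + 1) / 2 : ℤ) : ℝ)}

/-- The cell whose relative interior contains `x`. -/
noncomputable def carrier (N : ℕ) (x : Fin j → ℝ) (i : Fin j) : ℤ := ⌊N * x i⌋ + ⌈N * x i⌉

/-- The cell `d` is a face of the cell `c`. -/
def IsFace (d c : Fin j → ℤ) : Prop := ∀ i, c i / 2 ≤ d i / 2 ∧ (d i + 1) / 2 ≤ (c i + 1) / 2

/-- The dimension of a cell. -/
def cellDim (c : Fin j → ℤ) : ℕ := Fintype.card {i // c i % 2 = 1}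

theorem floor_add_ceil_div (r : ℝ) :
    (⌊r⌋ + ⌈r⌉) / 2 = ⌊r⌋ ∧ (⌊r⌋ + ⌈r⌉ + 1) / 2 = ⌈r⌉ := by
  have h1 := Int.floor_le_ceil r
  have h2 := Int.ceil_le_floor_add_one r
  omega

/-- The bounds of a cell are integers, so they can be tested on the floor and the ceiling of the
scaled coordinates. Geometric membership thus becomes arithmetic that `omega` can handle. -/
theorem mem_cellSet_iff {N : ℕ} {c : Fin j → ℤ} {x : Fin j → ℝ} :
    x ∈ cellSet N c ↔ IsFace (carrier N x) c := by
  refine forall_congr' fun i => ?_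
  rw [carrier, (floor_add_ceil_div _).1, (floor_add_ceil_div _).2, Int.le_floor, Int.ceil_le]

theorem IsFace.refl (c : Fin j → ℤ) : IsFace c c := fun _ => ⟨le_rfl, le_rfl⟩

theorem IsFace.trans {b c d : Fin j → ℤ} (h : IsFace b c) (h' : IsFace c d) : IsFace b d :=
  fun i => ⟨(h' i).1.trans (h i).1, (h i).2.trans (h' i).2⟩

theorem mem_cellSet_carrier (N : ℕ) (x : Fin j → ℝ) : x ∈ cellSet N (carrier N x) :=
  mem_cellSet_iff.2 (IsFace.refl _)

theorem cellDim_lt {c d : Fin j → ℤ} (h : IsFace d c) (hne : d ≠ c) : cellDim d < cellDim c := by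
  rw [cellDim, cellDim, Fintype.card_subtype, Fintype.card_subtype]
  refine Finset.card_lt_card (Finset.ssubset_iff_of_subset ?_ |>.2 ?_)
  · intro i hi
    simp only [Finset.mem_filter, Finset.mem_univ, true_and] at hi ⊢
    have := h i
    omega
  · obtain ⟨i, hi⟩ := Function.ne_iff.1 hne
    refine ⟨i, ?_, ?_⟩ <;> simp only [Finset.mem_filter, Finset.mem_univ, true_and] <;>
      have := h i <;> omega

theorem cellDim_le (c : Fin j → ℤ) : cellDim c ≤ j :=
  (Fintype.card_subtype_le _).trans (Fintype.card_fin j).le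

theorem cellDim_lt_of_even {c : Fin j → ℤ} {i : Fin j} (h : c i % 2 = 0) : cellDim c < j := by
  conv_rhs => rw [← Fintype.card_fin j]
  exact Fintype.card_subtype_lt (x := i) (by omega)

theorem isClosed_cellSet (N : ℕ) (c : Fin j → ℤ) : IsClosed (cellSet N c) := by
  simp only [cellSet, ofPred_forall, ofPred_and]
  exact isClosed_iInter fun i => (isClosed_le (by fun_prop) (by fun_prop)).inter
    (isClosed_le (by fun_prop) (by fun_prop))

theorem FinMap.mono {E V : Type*} [TopologicalSpace E] {D D' : Set E} {Y Y' : E → Set (V → ℝ)}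
    {F : E → V → ℝ} (h : FinMap D Y F) (hD : D' ⊆ D) (hY : ∀ x ∈ D', Y x ⊆ Y' x) :
    FinMap D' Y' F := by
  obtain ⟨h1, ⟨s, h2⟩, h3⟩ := h
  exact ⟨fun v => (h1 v).mono hD, ⟨s, fun x hx => h2 x (hD hx)⟩, fun x hx => hY x hx (h3 x (hD hx))⟩

theorem FinMap.comp {E E' V : Type*} [TopologicalSpace E] [TopologicalSpace E'] {D : Set E}
    {D' : Set E'} {Y : E → Set (V → ℝ)} {Y' : E' → Set (V → ℝ)} {F : E → V → ℝ}
    (h : FinMap D Y F) {a : E' → E} (ha : ContinuousOn a D') (hm : MapsTo a D' D)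
    (hY : ∀ x ∈ D', Y (a x) ⊆ Y' x) : FinMap D' Y' fun x => F (a x) := by
  obtain ⟨h1, ⟨s, h2⟩, h3⟩ := h
  exact ⟨fun v => (h1 v).comp ha hm, ⟨s, fun x hx => h2 _ (hm hx)⟩,
    fun x hx => hY x hx (h3 _ (hm hx))⟩

theorem FinMap.congr {E V : Type*} [TopologicalSpace E] {D : Set E} {Y : E → Set (V → ℝ)}
    {F G : E → V → ℝ} (h : FinMap D Y F) (hG : EqOn G F D) : FinMap D Y G := by
  obtain ⟨h1, ⟨s, h2⟩, h3⟩ := h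
  exact ⟨fun v => (h1 v).congr fun x hx => congrFun (hG hx) v,
    ⟨s, fun x hx => by rw [hG hx]; exact h2 x hx⟩, fun x hx => by rw [hG hx]; exact h3 x hx⟩

theorem FinMap.union {E V : Type*} [TopologicalSpace E] {D D' : Set E} {Y : E → Set (V → ℝ)}
    {F : E → V → ℝ} (h : FinMap D Y F) (h' : FinMap D' Y F) (hD : IsClosed D)
    (hD' : IsClosed D') : FinMap (D ∪ D') Y F := by
  classical
  obtain ⟨h1, ⟨s, h2⟩, h3⟩ := h
  obtain ⟨h1', ⟨s', h2'⟩, h3'⟩ := h'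
  refine ⟨fun v => (h1 v).union_of_isClosed (h1' v) hD hD', ⟨s ∪ s', ?_⟩, ?_⟩
  · rintro x (hx | hx) v hv <;> simp only [Finset.mem_union, not_or] at hv
    exacts [h2 x hx v hv.1, h2' x hx v hv.2]
  · rintro x (hx | hx)
    exacts [h3 x hx, h3' x hx]

theorem exists_extension_cell {V : Type*} {K : PreAbstractSimplicialComplex V} {N : ℕ}
    (hN : 0 < N) (c : Fin j → ℤ) (hK : FillsCube (cellDim c) K) {F : (Fin j → ℝ) → V → ℝ}
    (hF : FinMap {x | x ∈ cellSet N c ∧ carrier N x ≠ c} (fun _ => points K) F) :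
    ∃ F', FinMap (cellSet N c) (fun _ => points K) F' ∧
      EqOn F' F {x | x ∈ cellSet N c ∧ carrier N x ≠ c} := by
  have hN' : (N : ℝ) ≠ 0 := by positivity
  -- The odd entries are the free directions of the cell. `A` parametrizes the cell by a cube in
  -- these directions and `B` recovers the parameters; the boundary of the cube matches the points
  -- carried by proper faces.
  let e : {i // c i % 2 = 1} ≃ Fin (cellDim c) := Fintype.equivFin _
  let A : (Fin (cellDim c) → ℝ) → Fin j → ℝ := fun u i =>
    (((c i / 2 : ℤ) : ℝ) + if h : c i % 2 = 1 then u (e ⟨i, h⟩) else 0) / N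
  let B : (Fin j → ℝ) → Fin (cellDim c) → ℝ := fun x l =>
    N * x (e.symm l).1 - ((c (e.symm l).1 / 2 : ℤ) : ℝ)
  have hAi : ∀ u i, N * A u i =
      ((c i / 2 : ℤ) : ℝ) + if h : c i % 2 = 1 then u (e ⟨i, h⟩) else 0 :=
    fun u i => mul_div_cancel₀ _ hN'
  have hAc : Continuous A := by
    refine continuous_pi fun i => Continuous.div_const (Continuous.add continuous_const ?_) _
    split_ifs <;> fun_prop
  have hBc : Continuous B := by fun_prop
  have hodd : ∀ i, c i % 2 = 1 → (((c i + 1) / 2 : ℤ) : ℝ) = ((c i / 2 : ℤ) : ℝ) + 1 := by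
    intro i hi
    exact_mod_cast (by omega : (c i + 1) / 2 = c i / 2 + 1)
  have heven : ∀ i, ¬ c i % 2 = 1 → (((c i + 1) / 2 : ℤ) : ℝ) = ((c i / 2 : ℤ) : ℝ) := by
    intro i hi
    exact_mod_cast (by omega : (c i + 1) / 2 = c i / 2)
  have hAm : ∀ u ∈ cube (Fin (cellDim c)), A u ∈ cellSet N c := by
    intro u hu i
    rw [hAi]
    split_ifs with h
    · rw [hodd i h]
      have := hu (e ⟨i, h⟩)
      constructor <;> linarith [this.1, this.2]
    · rw [heven i h]; simp
  have hAb : ∀ u ∈ cubeBd (Fin (cellDim c)), carrier N (A u) ≠ c := by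
    rintro u ⟨hu, l, hl⟩ heq
    obtain ⟨⟨i, hi⟩, rfl⟩ := e.surjective l
    have h1 := hAi u i
    rw [dif_pos hi] at h1
    have h2 := congrFun heq i
    have : ∃ z : ℤ, N * A u i = z := by
      rcases hl with hl | hl
      · exact ⟨c i / 2, by rw [h1, hl, add_zero]⟩
      · exact ⟨c i / 2 + 1, by rw [h1, hl]; push_cast; ring⟩
    obtain ⟨z, hz⟩ := this
    rw [carrier, hz, Int.floor_intCast, Int.ceil_intCast] at h2
    omega
  have hBm : ∀ x ∈ cellSet N c, B x ∈ cube (Fin (cellDim c)) := by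
    intro x hx l
    obtain ⟨h1, h2⟩ := hx (e.symm l).1
    rw [hodd _ (e.symm l).2] at h2
    constructor <;> simp only [B] <;> linarith
  have hBb : ∀ x ∈ cellSet N c, carrier N x ≠ c → B x ∈ cubeBd (Fin (cellDim c)) := by
    intro x hx hne
    refine ⟨hBm x hx, ?_⟩
    obtain ⟨i, hi⟩ := Function.ne_iff.1 hne
    have hf := mem_cellSet_iff.1 hx i
    simp only [carrier] at hi hf
    rw [(floor_add_ceil_div _).1, (floor_add_ceil_div _).2] at hf
    have h1 := Int.floor_le_ceil (N * x i)
    have hci : c i % 2 = 1 := by omega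
    have h2 : ⌊N * x i⌋ = ⌈N * x i⌉ := by omega
    have h3 : N * x i = ⌊N * x i⌋ := le_antisymm (by rw [h2]; exact Int.le_ceil _) (Int.floor_le _)
    refine ⟨e ⟨i, hci⟩, ?_⟩
    simp only [B, e.symm_apply_apply]
    rcases (by omega : ⌊N * x i⌋ = c i / 2 ∨ ⌊N * x i⌋ = c i / 2 + 1) with h4 | h4
    · left; rw [h3, h4, sub_self]
    · right; rw [h3, h4]; push_cast; ring
  have hAB : ∀ x ∈ cellSet N c, A (B x) = x := by
    intro x hx
    funext i
    refine mul_left_cancel₀ hN' ?_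
    rw [hAi]
    split_ifs with h
    · simp [B]
    · have := hx i
      rw [heven i h] at this
      linarith [this.1, this.2]
  obtain ⟨g, hg, hgF⟩ := hK (fun u => F (A u)) (hF.comp hAc.continuousOn
    (fun u hu => ⟨hAm u hu.1, hAb u hu⟩) fun _ _ => Subset.rfl)
  refine ⟨fun x => g (B x), hg.comp hBc.continuousOn hBm fun _ _ => Subset.rfl, ?_⟩
  rintro x ⟨hx, hne⟩
  simp only [hgF (hBb x hx hne), hAB x hx]

theorem carrier_mem_iff {N : ℕ} {A : Finset (Fin j → ℤ)}
    (hA : ∀ c ∈ A, ∀ d, IsFace d c → d ∈ A) {x : Fin j → ℝ} :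
    carrier N x ∈ A ↔ ∃ c ∈ A, x ∈ cellSet N c :=
  ⟨fun h => ⟨_, h, mem_cellSet_carrier N x⟩,
    fun ⟨c, hc, hx⟩ => hA c hc _ (mem_cellSet_iff.1 hx)⟩

theorem isClosed_carrier_mem {N : ℕ} {A : Finset (Fin j → ℤ)}
    (hA : ∀ c ∈ A, ∀ d, IsFace d c → d ∈ A) : IsClosed {x : Fin j → ℝ | carrier N x ∈ A} := by
  have : {x : Fin j → ℝ | carrier N x ∈ A} = ⋃ c ∈ A, cellSet N c := by
    ext x
    simp only [mem_ofPred_eq, carrier_mem_iff hA, mem_iUnion, exists_prop]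
  rw [this]
  exact A.finite_toSet.isClosed_biUnion fun c _ => isClosed_cellSet N c

/-- Obstruction theory without homotopy groups. The target may vary from point to point, but on each
cell still to be filled it must be one constant complex that fills cubes of that dimension. -/
theorem exists_extension {V : Type*} {N : ℕ} (hN : 0 < N) {D A : Finset (Fin j → ℤ)}
    (hD : ∀ c ∈ D, ∀ d, IsFace d c → d ∈ D) (hA : ∀ c ∈ A, ∀ d, IsFace d c → d ∈ A) (hAD : A ⊆ D)
    {Y : (Fin j → ℝ) → Set (V → ℝ)} {F : (Fin j → ℝ) → V → ℝ}
    (hF : FinMap {x | carrier N x ∈ A} Y F)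
    (h : ∀ c ∈ D, c ∉ A → ∃ K : PreAbstractSimplicialComplex V, FillsCube (cellDim c) K ∧
      ∀ x ∈ cellSet N c, Y x = points K) :
    ∃ F', FinMap {x | carrier N x ∈ D} Y F' ∧ EqOn F' F {x | carrier N x ∈ A} := by
  classical
  induction hn : (D \ A).card generalizing A F with
  | zero =>
    have : A = D := hAD.antisymm (by simpa [Finset.sdiff_eq_empty_iff_subset] using hn)
    subst this
    exact ⟨F, hF, fun _ _ => rfl⟩
  | succ n ih =>
    -- A missing cell of least dimension has all its proper faces already in `A`.
    obtain ⟨c, hc, hmin⟩ := Finset.exists_min_image (D \ A) cellDim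
      (Finset.card_pos.1 (by omega))
    rw [Finset.mem_sdiff] at hc
    have hface : ∀ d, IsFace d c → d ≠ c → d ∈ A := fun d hd hne => by_contra fun hdA =>
      (hmin d (Finset.mem_sdiff.2 ⟨hD c hc.1 d hd, hdA⟩)).not_gt (cellDim_lt hd hne)
    obtain ⟨K, hK, hY⟩ := h c hc.1 hc.2
    obtain ⟨Fc, hFc, hFcF⟩ := exists_extension_cell hN c hK
      (hF.mono (fun x hx => hface _ (mem_cellSet_iff.1 hx.1) hx.2) fun x hx => (hY x hx.1).le)
    let G : (Fin j → ℝ) → V → ℝ := fun x => if carrier N x = c then Fc x else F x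
    have hGA : EqOn G F {x | carrier N x ∈ A} := fun x hx =>
      if_neg fun h' => hc.2 (by simpa only [mem_ofPred_eq, h'] using hx)
    have hGc : EqOn G Fc (cellSet N c) := by
      intro x hx
      by_cases h' : carrier N x = c
      · exact if_pos h'
      · exact (if_neg h').trans (hFcF ⟨hx, h'⟩).symm
    have hA' : ∀ b ∈ insert c A, ∀ d, IsFace d b → d ∈ insert c A := by
      intro b hb d hd
      rcases Finset.mem_insert.1 hb with rfl | hb
      · by_cases hdb : d = b
        · exact hdb ▸ Finset.mem_insert_self _ _
        · exact Finset.mem_insert_of_mem (hface d hd hdb)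
      · exact Finset.mem_insert_of_mem (hA b hb d hd)
    have hset : {x | carrier N x ∈ insert c A} = {x | carrier N x ∈ A} ∪ cellSet N c := by
      ext x
      simp only [mem_ofPred_eq, mem_union, carrier_mem_iff hA', carrier_mem_iff hA,
        Finset.exists_mem_insert, or_comm]
    have hG : FinMap {x | carrier N x ∈ insert c A} Y G := by
      rw [hset]
      exact (hF.congr hGA).union ((hFc.congr hGc).mono Subset.rfl fun x hx => (hY x hx).ge)
        (isClosed_carrier_mem hA) (isClosed_cellSet N c)
    obtain ⟨F', hF', hFG⟩ := ih hA' (Finset.insert_subset hc.1 hAD) hG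
      (fun d hd hdA => h d hd fun h' => hdA (Finset.mem_insert_of_mem h')) (by
        rw [Finset.sdiff_insert, Finset.card_erase_of_mem (Finset.mem_sdiff.2 hc), hn]; rfl)
    exact ⟨F', hF', fun x hx => (hFG (Finset.mem_insert_of_mem hx)).trans (hGA hx)⟩

/-- The cells of the grid contained in the unit cube. -/
noncomputable def cubeCells (j N : ℕ) : Finset (Fin j → ℤ) :=
  Fintype.piFinset fun _ => Finset.Icc 0 (2 * N : ℤ)

/-- The cells of the grid contained in the boundary of the unit cube. -/
noncomputable def cubeBdCells (j N : ℕ) : Finset (Fin j → ℤ) :=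
  (cubeCells j N).filter fun c => ∃ i, c i = 0 ∨ c i = 2 * N

theorem mem_cubeCells {N : ℕ} {c : Fin j → ℤ} :
    c ∈ cubeCells j N ↔ ∀ i, 0 ≤ c i ∧ c i ≤ 2 * N := by
  simp [cubeCells]

theorem isFace_mem_cubeCells {N : ℕ} : ∀ c ∈ cubeCells j N, ∀ d, IsFace d c → d ∈ cubeCells j N := by
  intro c hc d hd
  rw [mem_cubeCells] at hc ⊢
  intro i
  have := hc i
  have := hd i
  omega

theorem isFace_mem_cubeBdCells {N : ℕ} :
    ∀ c ∈ cubeBdCells j N, ∀ d, IsFace d c → d ∈ cubeBdCells j N := by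
  intro c hc d hd
  simp only [cubeBdCells, Finset.mem_filter] at hc ⊢
  refine ⟨isFace_mem_cubeCells c hc.1 d hd, ?_⟩
  obtain ⟨i, hi⟩ := hc.2
  refine ⟨i, ?_⟩
  have := hd i
  omega

theorem carrier_mem_cubeCells {N : ℕ} (hN : 0 < N) {x : Fin j → ℝ} :
    carrier N x ∈ cubeCells j N ↔ x ∈ cube (Fin j) := by
  have hN' : (0 : ℝ) < N := by positivity
  rw [mem_cubeCells]
  refine forall_congr' fun i => ?_
  have h1 := Int.floor_le_ceil (N * x i)
  have h2 := Int.ceil_le_floor_add_one (N * x i)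
  rw [mem_Icc, carrier]
  trans 0 ≤ ⌊N * x i⌋ ∧ ⌈N * x i⌉ ≤ N
  · omega
  · rw [Int.le_floor, Int.ceil_le]
    push_cast
    rw [mul_nonneg_iff_of_pos_left hN', mul_le_iff_le_one_right hN']

theorem carrier_mem_cubeBdCells {N : ℕ} (hN : 0 < N) {x : Fin j → ℝ} :
    carrier N x ∈ cubeBdCells j N ↔ x ∈ cubeBd (Fin j) := by
  have hN' : (N : ℝ) ≠ 0 := by positivity
  rw [cubeBdCells, Finset.mem_filter, carrier_mem_cubeCells hN]
  refine and_congr_right fun hx => exists_congr fun i => ?_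
  have h1 := Int.floor_le_ceil (N * x i)
  have h2 := Int.ceil_le_floor_add_one (N * x i)
  have h3 := Int.floor_le (N * x i)
  have h4 := Int.le_ceil (N * x i)
  rw [carrier]
  have key : ∀ z : ℤ, ⌊N * x i⌋ + ⌈N * x i⌉ = 2 * z ↔ N * x i = z := by
    intro z
    constructor
    · intro h
      have h5 : ⌊N * x i⌋ = z := by omega
      have h6 : ⌈N * x i⌉ = z := by omega
      rw [h5] at h3; rw [h6] at h4
      exact le_antisymm h4 h3
    · intro h
      rw [h, Int.floor_intCast, Int.ceil_intCast]; ring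
  have h0 := key 0
  have hN1 := key N
  rw [mul_zero, Int.cast_zero, mul_eq_zero, or_iff_right hN'] at h0
  rw [Int.cast_natCast, mul_eq_left₀ hN'] at hN1
  rw [h0, hN1]

/-- Only the finitely many coordinates in `s` matter, so uniform continuity on the compact set
applies; cells of mesh 1/N have diameter at most 1/N in the sup metric. -/
theorem exists_fine {V : Type*} {D : Set (Fin j → ℝ)} (hD : IsCompact D)
    {G : (Fin j → ℝ) → V → ℝ} (hG : ∀ v, ContinuousOn (fun x => G x v) D) {s : Finset V}
    (hs : ∀ x ∈ D, ∀ v, v ∉ s → G x v = 0) {ε : ℝ} (hε : 0 < ε) :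
    ∃ N : ℕ, 0 < N ∧ ∀ c, ∀ x ∈ cellSet N c, x ∈ D → ∀ y ∈ cellSet N c, y ∈ D → ∀ v,
      |G x v - G y v| < ε := by
  have hc : ContinuousOn (fun x (v : s) => G x v) D := continuousOn_pi.2 fun v => hG v
  obtain ⟨δ, hδ, h⟩ := Metric.uniformContinuousOn_iff.1
    (hD.uniformContinuousOn_of_continuous hc) ε hε
  obtain ⟨n, hn⟩ := exists_nat_one_div_lt hδ
  refine ⟨n + 1, Nat.succ_pos n, fun c x hx hxD y hy hyD v => ?_⟩
  by_cases hv : v ∈ s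
  · have hxy : dist x y < δ := by
      refine lt_of_le_of_lt ((dist_pi_le_iff (by positivity)).2 fun i => ?_) hn
      rw [Real.dist_eq, abs_le, ← sub_nonneg, ← sub_nonneg (b := x i - y i)]
      have hn0 : (0 : ℝ) < n + 1 := by positivity
      have h1 := hx i
      have h2 := hy i
      have h3 : (((c i + 1) / 2 : ℤ) : ℝ) ≤ ((c i / 2 : ℤ) : ℝ) + 1 := by
        exact_mod_cast (by omega : (c i + 1) / 2 ≤ c i / 2 + 1)
      push_cast at h1 h2
      constructor
      · have : x i - y i - -(1 / ((n : ℝ) + 1)) = ((n + 1) * x i - (n + 1) * y i + 1) / (n + 1) := by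
          field_simp
          ring
        rw [this]
        exact div_nonneg (by linarith) hn0.le
      · have : 1 / ((n : ℝ) + 1) - (x i - y i) = (1 - ((n + 1) * x i - (n + 1) * y i)) / (n + 1) := by
          field_simp
        rw [this]
        exact div_nonneg (by linarith) hn0.le
    have h4 := h x hxD y hyD hxy
    exact (Real.dist_eq _ _ ▸ dist_le_pi_dist (fun v : s => G x v) (fun v : s => G y v)
      ⟨v, hv⟩).trans_lt h4
  · rw [hs x hxD v hv, hs y hyD v hv, sub_self, abs_zero]
    exact hε

end

/-! ### Straight-line homotopies, cones, and deletion of independent vertices -/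

section

variable {V : Type*} {K L : PreAbstractSimplicialComplex V}

theorem combo_mem_points {t : Finset V} (ht : t ∈ K.faces) {y z : V → ℝ} (hy : ∀ v, 0 ≤ y v)
    (hz : ∀ v, 0 ≤ z v) (hyt : ∀ v, v ∉ t → y v = 0) (hzt : ∀ v, v ∉ t → z v = 0)
    (hy1 : ∑ v ∈ t, y v = 1) (hz1 : ∑ v ∈ t, z v = 1) {a : ℝ} (ha : a ∈ Icc (0 : ℝ) 1) :
    (fun v => (1 - a) * y v + a * z v) ∈ points K := by
  refine ⟨fun v => ?_, t, ht, fun v hv => ?_, ?_⟩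
  · exact add_nonneg (mul_nonneg (by linarith [ha.2]) (hy v)) (mul_nonneg ha.1 (hz v))
  · simp only [hyt v hv, hzt v hv]; ring
  · rw [Finset.sum_add_distrib, ← Finset.mul_sum, ← Finset.mul_sum, hy1, hz1]; ring

theorem exists_abs_eq_norm {j : ℕ} {z : Fin j → ℝ} (hz : 0 < ‖z‖) : ∃ i, |z i| = ‖z‖ := by
  by_contra! h
  exact lt_irrefl _ ((pi_norm_lt_iff hz).2 fun i => lt_of_le_of_ne (norm_le_pi_norm z i) (h i))

/-- Extendability over the cube is invariant under straight-line homotopies. -/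
theorem exists_extension_of_segment {j : ℕ} {f₀ f₁ g₁ : (Fin j → ℝ) → V → ℝ}
    (h₀ : FinMap (cubeBd (Fin j)) (fun _ => points K) f₀)
    (hseg : ∀ x ∈ cubeBd (Fin j), ∀ a ∈ Icc (0 : ℝ) 1,
      (fun v => (1 - a) * f₀ x v + a * f₁ x v) ∈ points K)
    (hg : FinMap (cube (Fin j)) (fun _ => points K) g₁) (hgf : EqOn g₁ f₁ (cubeBd (Fin j))) :
    ∃ g₀, FinMap (cube (Fin j)) (fun _ => points K) g₀ ∧ EqOn g₀ f₀ (cubeBd (Fin j)) := by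
  classical
  -- `ρ` is the sup-distance from the centre, scaled to be 1 on the boundary. The map `p` stretches
  -- the inner cube `ρ ≤ 1/2` over the whole cube and projects the collar `ρ ≥ 1/2` radially to the
  -- boundary. The extension is `g₁ ∘ p` inside, and the collar carries the homotopy with parameter
  -- 2 - 2ρ.
  let ρ : (Fin j → ℝ) → ℝ := fun x => ‖fun i => 2 * x i - 1‖
  have hρc : Continuous ρ := by fun_prop
  have hρ0 : ∀ x, 0 ≤ ρ x := fun x => norm_nonneg _
  have hρi : ∀ x i, |2 * x i - 1| ≤ ρ x := fun x i => norm_le_pi_norm (fun i => 2 * x i - 1) i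
  have hm : ∀ x, 0 < max (ρ x) (1 / 2) := fun x => lt_max_of_lt_right (by norm_num)
  let p : (Fin j → ℝ) → Fin j → ℝ := fun x i => 1 / 2 + (2 * x i - 1) / max (ρ x) (1 / 2) / 2
  have hpc : Continuous p := by
    refine continuous_pi fun i => ?_
    refine continuous_const.add (((by fun_prop : Continuous fun x : Fin j → ℝ => 2 * x i - 1).div
      (hρc.max continuous_const) fun x => (hm x).ne').div_const _)
  have hp : ∀ x, p x ∈ cube (Fin j) := by
    intro x i
    have h1 : |(2 * x i - 1) / max (ρ x) (1 / 2)| ≤ 1 := by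
      rw [abs_div, abs_of_pos (hm x), div_le_one (hm x)]
      exact (hρi x i).trans (le_max_left _ _)
    rw [abs_le] at h1
    constructor <;> simp only [p] <;> linarith [h1.1, h1.2]
  have hpb : ∀ x, 1 / 2 ≤ ρ x → p x ∈ cubeBd (Fin j) := by
    intro x hx
    refine ⟨hp x, ?_⟩
    have hpos : 0 < ρ x := by linarith
    obtain ⟨i, hi⟩ := exists_abs_eq_norm hpos
    refine ⟨i, ?_⟩
    simp only [p, max_eq_left hx]
    change |2 * x i - 1| = ρ x at hi
    rcases abs_choice (2 * x i - 1) with h | h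
    · right
      rw [← h, hi, div_self hpos.ne']; norm_num
    · left
      rw [hi] at h
      rw [show 2 * x i - 1 = -ρ x by linarith, neg_div, div_self hpos.ne']; norm_num
  have hρ1 : ∀ x ∈ cube (Fin j), ρ x ≤ 1 := by
    intro x hx
    refine (pi_norm_le_iff_of_nonneg zero_le_one).2 fun i => ?_
    rw [Real.norm_eq_abs, abs_le]
    constructor <;> linarith [(hx i).1, (hx i).2]
  have hρb : ∀ x ∈ cubeBd (Fin j), ρ x = 1 := by
    rintro x ⟨hx, i, hi⟩
    refine le_antisymm (hρ1 x hx) ((?_ : (1 : ℝ) ≤ _).trans (hρi x i))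
    rcases hi with hi | hi <;> rw [hi] <;> norm_num
  have hpid : ∀ x ∈ cubeBd (Fin j), p x = x := by
    intro x hx
    funext i
    simp only [p, hρb x hx]
    rw [max_eq_left (by norm_num), div_one]; ring
  let H : (Fin j → ℝ) → V → ℝ := fun x v =>
    (1 - (2 - 2 * ρ x)) * f₀ (p x) v + (2 - 2 * ρ x) * g₁ (p x) v
  let g : (Fin j → ℝ) → V → ℝ := fun x => if 1 / 2 ≤ ρ x then H x else g₁ (p x)
  have hg1 : EqOn g (fun x => g₁ (p x)) (cube (Fin j) ∩ {x | ρ x ≤ 1 / 2}) := by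
    rintro x ⟨-, hx⟩
    by_cases h : 1 / 2 ≤ ρ x
    · have h' : ρ x = 1 / 2 := le_antisymm hx h
      refine (if_pos h).trans ?_
      funext v
      simp only [H, h']; ring
    · exact if_neg h
  have hg2 : EqOn g H (cube (Fin j) ∩ {x | 1 / 2 ≤ ρ x}) := fun x hx => if_pos hx.2
  have hunion : cube (Fin j) =
      (cube (Fin j) ∩ {x | ρ x ≤ 1 / 2}) ∪ (cube (Fin j) ∩ {x | 1 / 2 ≤ ρ x}) := by
    ext x
    simp only [mem_union, mem_inter_iff, mem_ofPred_eq]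
    have := le_total (ρ x) (1 / 2)
    tauto
  refine ⟨g, ?_, fun x hx => ?_⟩
  · rw [hunion]
    refine FinMap.union ((hg.comp hpc.continuousOn (fun x _ => hp x)
      fun _ _ => Subset.rfl).congr hg1) (FinMap.congr ?_ hg2)
      ((isClosed_cube _).inter (isClosed_le hρc continuous_const))
      ((isClosed_cube _).inter (isClosed_le continuous_const hρc))
    obtain ⟨c1, ⟨s, hs⟩, -⟩ := h₀
    obtain ⟨c2, ⟨s', hs'⟩, -⟩ := hg
    refine ⟨fun v => ?_, ⟨s ∪ s', fun x hx v hv => ?_⟩, fun x hx => ?_⟩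
    · have e1 : ContinuousOn (fun x => f₀ (p x) v) (cube (Fin j) ∩ {x | 1 / 2 ≤ ρ x}) :=
        (c1 v).comp hpc.continuousOn fun x hx => hpb x hx.2
      have e2 : ContinuousOn (fun x => g₁ (p x) v) (cube (Fin j) ∩ {x | 1 / 2 ≤ ρ x}) :=
        (c2 v).comp hpc.continuousOn fun x _ => hp x
      have e3 : Continuous fun x => 2 - 2 * ρ x := by fun_prop
      exact ((continuousOn_const.sub e3.continuousOn).mul e1).add (e3.continuousOn.mul e2)
    · rw [Finset.mem_union, not_or] at hv
      simp only [H, hs _ (hpb x hx.2) v hv.1, hs' _ (hp x) v hv.2]; ring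
    · have h1 := hρ1 x hx.1
      have h2 : 1 / 2 ≤ ρ x := hx.2
      have := hseg (p x) (hpb x hx.2) (2 - 2 * ρ x) ⟨by linarith, by linarith⟩
      simpa only [H, hgf (hpb x hx.2)] using this
  · have h1 := hρb x hx
    rw [show g x = H x from if_pos (by rw [h1]; norm_num)]
    funext v
    simp only [H, hpid x hx, h1]; ring

/-- A cone is contractible. -/
theorem conn_of_cone (v : V) (hv : {v} ∈ K.faces)
    (h : ∀ t ∈ K.faces, ∃ u ∈ K.faces, t ⊆ u ∧ v ∈ u) (k : ℤ) : Conn k K := by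
  classical
  intro i _ f hf
  have h0 : ∀ w, (0 : ℝ) ≤ (Pi.single v 1 : V → ℝ) w := fun w => by
    by_cases hw : w = v
    · subst hw; simp
    · simp [hw]
  refine exists_extension_of_segment (f₁ := fun _ => Pi.single v 1)
    (g₁ := fun _ => Pi.single v 1) hf ?_ ?_ fun _ _ => rfl
  · intro x hx a ha
    have hfx := hf.2.2 x hx
    obtain ⟨hy0, t, ht, ht0, -⟩ := id hfx
    obtain ⟨u, hu, htu, hvu⟩ := h t ht
    have htu0 : ∀ w, w ∉ u → f x w = 0 := fun w hw => ht0 w fun h' => hw (htu h')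
    refine combo_mem_points hu hy0 h0 htu0 (fun w hw => ?_) (points_sum_eq_one hfx htu0) ?_ ha
    · exact Pi.single_eq_of_ne (by rintro rfl; exact hw hvu) _
    · rw [Finset.sum_pi_single', if_pos hvu]
  · refine ⟨fun _ => continuousOn_const, ⟨{v}, fun x _ w hw => ?_⟩, fun x _ => ⟨h0, {v}, hv, ?_, ?_⟩⟩
    · exact Pi.single_eq_of_ne (by simpa using hw) _
    · exact fun w hw => Pi.single_eq_of_ne (by simpa using hw) _
    · simp

/-- The full subcomplex on the vertices outside `I`. -/
def deletion (L : PreAbstractSimplicialComplex V) (I : Set V) : PreAbstractSimplicialComplex V where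
  faces := {t | t ∈ L.faces ∧ ∀ v ∈ t, v ∉ I}
  isRelLowerSet_faces := fun _ ht => ⟨face_nonempty ht.1,
    fun _ hu hn => ⟨face_mono ht.1 hu hn, fun v hv => ht.2 v (hu hv)⟩⟩

/-- No two vertices of `I` are joined by an edge. -/
def Independent (L : PreAbstractSimplicialComplex V) (I : Set V) : Prop :=
  ∀ t ∈ L.faces, ∀ v ∈ t, ∀ w ∈ t, v ∈ I → w ∈ I → v = w

theorem points_deletion_subset (I : Set V) : points (deletion L I) ⊆ points L :=
  fun _ ⟨h0, t, ht, h⟩ => ⟨h0, t, ht.1, h⟩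

open Classical in
/-- The total weight of the vertices of `I`, for points supported on `s`. -/
noncomputable def weightOn (I : Set V) (s : Finset V) (y : V → ℝ) : ℝ := ∑ v ∈ s with v ∈ I, y v

open Classical in
/-- Radial projection away from the vertices of `I`, for points supported on `s`. -/
noncomputable def radial (I : Set V) (s : Finset V) (y : V → ℝ) (w : V) : ℝ :=
  if w ∈ I then 0 else y w / (1 - weightOn I s y)

variable {I : Set V}

/-- Two vertices of `I` with nonzero weight would span an edge, so at most one of them carries
weight and the total weight is a single coordinate. -/
theorem weightOn_cases (hI : Independent L I) {y : V → ℝ} (hy : y ∈ points L) {s : Finset V}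
    (hs : ∀ v, v ∉ s → y v = 0) :
    ((∀ v ∈ I, y v = 0) ∧ weightOn I s y = 0) ∨
      ∃ v ∈ I, 0 < y v ∧ weightOn I s y = y v ∧ ∀ w ∈ I, w ≠ v → y w = 0 := by
  classical
  by_cases h : ∀ v ∈ I, y v = 0
  · exact Or.inl ⟨h, Finset.sum_eq_zero fun v hv => h v (Finset.mem_filter.1 hv).2⟩
  · right
    push Not at h
    obtain ⟨v, hvI, hv⟩ := h
    have h0 : ∀ w ∈ I, w ≠ v → y w = 0 := by
      intro w hw hne
      by_contra hw0
      have : ({v, w} : Finset V) ∈ L.faces := face_of_points hy (by simp [hv, hw0]) (by simp)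
      exact hne (hI _ this w (by simp) v (by simp) hw hvI)
    refine ⟨v, hvI, lt_of_le_of_ne (hy.1 v) (Ne.symm hv), ?_, h0⟩
    refine Finset.sum_eq_single v (fun w hw hne => h0 w (Finset.mem_filter.1 hw).2 hne) fun h' => ?_
    by_contra
    exact h' (Finset.mem_filter.2 ⟨by_contra fun h'' => hv (hs v h''), hvI⟩)

theorem radial_mem {y : V → ℝ} (hy : y ∈ points L) {s : Finset V} (hs : ∀ v, v ∉ s → y v = 0)
    (hlt : weightOn I s y < 1) : radial I s y ∈ points (deletion L I) := by
  classical
  have hsum : ∑ w ∈ s with w ∉ I, y w = 1 - weightOn I s y := by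
    rw [← points_sum_eq_one hy hs, weightOn, ← Finset.sum_filter_add_sum_filter_not s (· ∈ I) y]
    ring
  have hpos : 0 < 1 - weightOn I s y := by linarith
  let t := s.filter fun w => w ∉ I ∧ y w ≠ 0
  have ht : ∑ w ∈ t, y w = 1 - weightOn I s y := by
    rw [← hsum]
    refine Finset.sum_subset (fun w hw => ?_) fun w hw hw' => ?_
    · simp only [t, Finset.mem_filter] at hw ⊢; exact ⟨hw.1, hw.2.1⟩
    · simp only [t, Finset.mem_filter] at hw hw'; tauto
  have htm : ∀ w ∈ t, w ∉ I ∧ y w ≠ 0 := fun w hw => (Finset.mem_filter.1 hw).2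
  have htn : t.Nonempty := by
    by_contra h
    rw [Finset.not_nonempty_iff_eq_empty] at h
    rw [h, Finset.sum_empty] at ht
    linarith
  refine ⟨fun w => ?_, t, ⟨face_of_points hy (fun w hw => (htm w hw).2) htn,
    fun w hw => (htm w hw).1⟩, fun w hw => ?_, ?_⟩
  · rw [radial]
    split_ifs
    exacts [le_rfl, div_nonneg (hy.1 w) hpos.le]
  · rw [radial]
    split_ifs with h
    · rfl
    · by_cases hws : w ∈ s
      · have : y w = 0 := by_contra fun h' => hw (Finset.mem_filter.2 ⟨hws, h, h'⟩)
        rw [this, zero_div]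
      · rw [hs w hws, zero_div]
  · have hr : ∀ w ∈ t, radial I s y w = y w / (1 - weightOn I s y) := fun w hw =>
      if_neg (htm w hw).1
    rw [Finset.sum_congr rfl hr, ← Finset.sum_div, ht, div_self hpos.ne']

/-- The support of `z` avoids `I` and lies in that of `y`; adding `v` stays inside the support of
`y`, which is a simplex. Applied to radial projections. -/
theorem mem_points_link {y z : V → ℝ} (hy : y ∈ points L) (hz : z ∈ points (deletion L I))
    (hzy : ∀ w, z w ≠ 0 → y w ≠ 0) {v : V} (hv : v ∈ I) (hyv : y v ≠ 0) :
    z ∈ points (link L {v}) := by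
  classical
  obtain ⟨h0, t, ht, ht0, ht1⟩ := id hz
  have hs0 : ∀ w, w ∉ t.filter (fun w => z w ≠ 0) → z w = 0 := by
    intro w hw
    by_contra h
    exact h (ht0 w fun h' => hw (Finset.mem_filter.2 ⟨h', h⟩))
  have hs1 := points_sum_eq_one hz hs0
  refine ⟨h0, t.filter fun w => z w ≠ 0, ⟨?_, ?_, ?_⟩, hs0, hs1⟩
  · by_contra h
    rw [Finset.not_nonempty_iff_eq_empty] at h
    rw [h, Finset.sum_empty] at hs1
    exact zero_ne_one hs1
  · rw [Finset.disjoint_singleton_left]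
    intro h
    exact ht.2 v (Finset.mem_filter.1 h).1 hv
  · refine face_of_points hy (fun w hw => ?_) (by simp)
    rcases Finset.mem_union.1 hw with h | h
    · rw [Finset.mem_singleton.1 h]; exact hyv
    · exact hzy w (Finset.mem_filter.1 h).2

theorem points_link_subset {v : V} (hI : Independent L I) (hv : v ∈ I) :
    points (link L {v}) ⊆ points (deletion L I) := by
  classical
  rintro y ⟨h0, t, ⟨hn, hd, hu⟩, h⟩
  refine ⟨h0, t, ⟨face_mono hu Finset.subset_union_right hn, fun w hw hwI => ?_⟩, h⟩
  have := hI _ hu w (Finset.mem_union_right _ hw) v (by simp) hwI hv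
  rw [Finset.disjoint_singleton_left] at hd
  exact hd (this ▸ hw)

theorem continuousOn_weightOn {E : Type*} [TopologicalSpace E] {D : Set E} {G : E → V → ℝ}
    (hG : ∀ v, ContinuousOn (fun x => G x v) D) (s : Finset V) :
    ContinuousOn (fun x => weightOn I s (G x)) D :=
  continuousOn_finsetSum _ fun v _ => hG v

/-- A map of a cubical complex to `|L|` can be pushed off the vertices in `I` if the links of these
vertices are connected enough. -/
theorem exists_push {j N : ℕ} (hI : Independent L I) (hN : 0 < N) {D : Finset (Fin j → ℤ)}
    (hD : ∀ c ∈ D, ∀ d, IsFace d c → d ∈ D) {G : (Fin j → ℝ) → V → ℝ}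
    (hG : FinMap {x | carrier N x ∈ D} (fun _ => points L) G) {s : Finset V}
    (hs : ∀ x, carrier N x ∈ D → ∀ v, v ∉ s → G x v = 0)
    (hfine : ∀ c, ∀ x ∈ cellSet N c, carrier N x ∈ D → ∀ y ∈ cellSet N c, carrier N y ∈ D →
      ∀ v, |G x v - G y v| < 1 / 4)
    (hlink : ∀ c ∈ D, ∀ v ∈ I, {v} ∈ L.faces → FillsCube (cellDim c) (link L {v})) :
    ∃ G', FinMap {x | carrier N x ∈ D} (fun x => {y | y ∈ points (deletion L I) ∧
        ∀ v ∈ I, G x v ≠ 0 → y ∈ points (link L {v})}) G' ∧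
      ∀ x, carrier N x ∈ D → (∀ v ∈ I, G x v < 1 / 4) → G' x = radial I s (G x) := by
  classical
  have hcell : ∀ c ∈ D, ∀ x ∈ cellSet N c, carrier N x ∈ D := fun c hc x hx =>
    hD c hc _ (mem_cellSet_iff.1 hx)
  -- On these cells less than half of the weight lies on `I`, so radial projection is defined there.
  let A := D.filter fun c => ∀ x ∈ cellSet N c, ∀ v ∈ I, G x v < 1 / 2
  have hAD : A ⊆ D := Finset.filter_subset _ _
  have hA : ∀ c ∈ A, ∀ d, IsFace d c → d ∈ A := by
    intro c hc d hd
    rw [Finset.mem_filter] at hc ⊢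
    exact ⟨hD c hc.1 d hd,
      fun x hx => hc.2 x (mem_cellSet_iff.2 ((mem_cellSet_iff.1 hx).trans hd))⟩
  have hAlt : ∀ x, carrier N x ∈ A → weightOn I s (G x) < 1 / 2 := by
    intro x hx
    have h := (Finset.mem_filter.1 hx).2 x (mem_cellSet_carrier N x)
    rcases weightOn_cases hI (hG.2.2 x (hAD hx)) (hs x (hAD hx)) with h' | ⟨v, hv, -, h', -⟩
    · rw [h'.2]; norm_num
    · rw [h']; exact h v hv
  obtain ⟨G', hG', hGG⟩ := exists_extension hN hD hA hAD
    (Y := fun x => {y | y ∈ points (deletion L I) ∧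
        ∀ v ∈ I, G x v ≠ 0 → y ∈ points (link L {v})}) (F := fun x => radial I s (G x))
    (by
      refine ⟨fun w => ?_, ⟨s, fun x hx w hw => ?_⟩, fun x hx => ?_⟩
      · by_cases hw : w ∈ I
        · simp only [radial, if_pos hw]
          exact continuousOn_const
        · simp only [radial, if_neg hw]
          have hsub : {x | carrier N x ∈ A} ⊆ {x | carrier N x ∈ D} := fun x hx => hAD hx
          refine ((hG.1 w).mono hsub).div (continuousOn_const.sub
            (continuousOn_weightOn (fun v => (hG.1 v).mono hsub) s)) fun x hx => ?_
          have := hAlt x hx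
          linarith
      · simp only [radial, hs x (hAD hx) w hw, zero_div, ite_self]
      · have h1 := hG.2.2 x (hAD hx)
        have h2 := radial_mem (I := I) h1 (hs x (hAD hx)) (by linarith [hAlt x hx])
        refine ⟨h2, fun v hv hne => mem_points_link h1 h2 (fun w hw h => hw ?_) hv hne⟩
        simp only [radial, h, zero_div, ite_self])
    (by
      -- Some `v ∈ I` has weight at least 1/2 somewhere on such a cell, hence positive weight on all
      -- of it by fineness. By independence no other vertex of `I` has weight there, so the target
      -- is constantly the link of `v`.
      intro c hc hcA
      have : ∃ x ∈ cellSet N c, ∃ v ∈ I, 1 / 2 ≤ G x v := by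
        by_contra! h
        exact hcA (Finset.mem_filter.2 ⟨hc, h⟩)
      obtain ⟨x, hx, v, hv, hxv⟩ := this
      have hvx : ∀ y ∈ cellSet N c, G y v ≠ 0 := by
        intro y hy h0
        have := hfine c x hx (hcell c hc x hx) y hy (hcell c hc y hy) v
        rw [h0, sub_zero] at this
        linarith [le_abs_self (G x v)]
      refine ⟨link L {v}, hlink c hc v hv ?_, fun y hy => ?_⟩
      · exact face_of_points (hG.2.2 x (hcell c hc x hx)) (by simpa using hvx x hx) (by simp)
      · have hy' := hG.2.2 y (hcell c hc y hy)
        ext z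
        refine ⟨fun h => h.2 v hv (hvx y hy), fun h => ⟨points_link_subset hI hv h, ?_⟩⟩
        intro w hw hne
        have : ({v, w} : Finset V) ∈ L.faces :=
          face_of_points hy' (by simp [hne, hvx y hy]) (by simp)
        rw [hI _ this w (by simp) v (by simp) hw hv]
        exact h)
  -- Weights below 1/4 at `x` stay below 1/4 + 1/4 on its carrier, which therefore lies in `A`.
  refine ⟨G', hG', fun x hx hlt => hGG (Finset.mem_filter.2 ⟨hx, fun y hy v hv => ?_⟩)⟩
  have := hfine _ x (mem_cellSet_carrier N x) hx y hy (hcell _ hx y hy) v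
  linarith [hlt v hv, neg_abs_le (G x v - G y v)]

theorem radial_eq_self {y : V → ℝ} {s : Finset V} (h : ∀ v ∈ I, y v = 0) : radial I s y = y := by
  classical
  have h0 : weightOn I s y = 0 := Finset.sum_eq_zero fun v hv => h v (Finset.mem_filter.1 hv).2
  funext w
  rw [radial, h0, sub_zero, div_one]
  split_ifs with hw
  exacts [(h w hw).symm, rfl]

/-- Deleting independent vertices with `k`-connected links preserves `k`-connectivity. -/
theorem conn_deletion {k : ℤ} (hI : Independent L I) (hL : Conn k L)
    (hlink : ∀ v ∈ I, {v} ∈ L.faces → Conn k (link L {v})) : Conn k (deletion L I) := by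
  intro j hj f hf
  obtain ⟨G, hG, hGf⟩ := hL j hj f (hf.mono Subset.rfl fun _ _ => points_deletion_subset I)
  obtain ⟨s, hs⟩ := hG.2.1
  obtain ⟨N, hN, hfine⟩ := exists_fine (isCompact_cube (Fin j)) hG.1 hs (ε := 1 / 4) (by norm_num)
  have hset : {x : Fin j → ℝ | carrier N x ∈ cubeCells j N} = cube (Fin j) := by
    ext x; exact carrier_mem_cubeCells hN
  obtain ⟨G', hG', h⟩ := exists_push hI hN isFace_mem_cubeCells (hset.symm ▸ hG)
    (fun x hx => hs x ((carrier_mem_cubeCells hN).1 hx))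
    (fun c x hx hx' y hy hy' => hfine c x hx ((carrier_mem_cubeCells hN).1 hx') y hy
      ((carrier_mem_cubeCells hN).1 hy'))
    (fun c _ v hv hvL => hlink v hv hvL _ (by have := cellDim_le c; omega))
  rw [hset] at hG'
  refine ⟨G', hG'.mono Subset.rfl fun x _ y hy => hy.1, fun x hx => ?_⟩
  have h0 : ∀ v ∈ I, G x v = 0 := by
    intro v hv
    rw [hGf hx]
    obtain ⟨-, t, ht, ht0, -⟩ := hf.2.2 x hx
    exact ht0 v fun h' => ht.2 v h' hv
  rw [h x ((carrier_mem_cubeCells hN).2 hx.1) fun v hv => by rw [h0 v hv]; norm_num,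
    radial_eq_self h0, hGf hx]

/-- Adding independent vertices with `(k - 1)`-connected links preserves `k`-connectivity. -/
theorem conn_of_deletion {k : ℤ} (hI : Independent L I) (hK : Conn k (deletion L I))
    (hlink : ∀ v ∈ I, {v} ∈ L.faces → Conn (k - 1) (link L {v})) : Conn k L := by
  classical
  intro j hj f hf
  obtain ⟨s, hs⟩ := hf.2.1
  obtain ⟨N, hN, hfine⟩ := exists_fine (isCompact_cubeBd (Fin j)) hf.1 hs (ε := 1 / 4) (by norm_num)
  have hset : {x : Fin j → ℝ | carrier N x ∈ cubeBdCells j N} = cubeBd (Fin j) := by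
    ext x; exact carrier_mem_cubeBdCells hN
  obtain ⟨f', hf', hrad⟩ := exists_push hI hN isFace_mem_cubeBdCells (hset.symm ▸ hf)
    (fun x hx => hs x ((carrier_mem_cubeBdCells hN).1 hx))
    (fun c x hx hx' y hy hy' => hfine c x hx ((carrier_mem_cubeBdCells hN).1 hx') y hy
      ((carrier_mem_cubeBdCells hN).1 hy'))
    -- Boundary cells have an even entry and so dimension less than j; this is why (k-1)-connected
    -- links are enough.
    (fun c hc v hv hvL => hlink v hv hvL _ (by
      obtain ⟨i, hi⟩ := (Finset.mem_filter.1 hc).2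
      have := cellDim_lt_of_even (c := c) (i := i) (by omega)
      omega))
  rw [hset] at hf'
  replace hrad := fun x hx => hrad x ((carrier_mem_cubeBdCells hN).2 hx)
  obtain ⟨g, hg, hgf⟩ := hK j hj f' (hf'.mono Subset.rfl fun x _ y hy => hy.1)
  let h : (Fin j → ℝ) → ℝ := fun x => weightOn I s (f x)
  -- In general `f` and `f'` do not lie in a common simplex, so the homotopy goes through `f₁`,
  -- which multiplies the weight on `I` by 4, capped at 1. From weight 1/4 on, `f₁` is the vertex of
  -- `I` itself. The 3/4 only keeps the denominator positive: where it takes effect the numerator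
  -- vanishes.
  let f₁ : (Fin j → ℝ) → V → ℝ := fun x w =>
    if w ∈ I then min 1 (4 * f x w) else max 0 (1 - 4 * h x) / max (3 / 4) (1 - h x) * f x w
  have hden : ∀ x, 0 < max (3 / 4) (1 - h x) := fun x => lt_max_of_lt_left (by norm_num)
  have hf10 : ∀ x ∈ cubeBd (Fin j), ∀ w, 0 ≤ f₁ x w := by
    intro x hx w
    have := (hf.2.2 x hx).1 w
    simp only [f₁]
    split_ifs
    · exact le_min zero_le_one (by linarith)
    · exact mul_nonneg (div_nonneg (le_max_left _ _) (hden x).le) this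
  have hf1s : ∀ x w, f x w = 0 → f₁ x w = 0 := by
    intro x w hw
    simp only [f₁, hw, mul_zero]
    split_ifs <;> simp
  have hsum : ∀ x ∈ cubeBd (Fin j), ∑ w ∈ s, f₁ x w = 1 := by
    intro x hx
    have hx1 := points_sum_eq_one (hf.2.2 x hx) (hs x hx)
    have hsplit := Finset.sum_filter_add_sum_filter_not s (· ∈ I) (f₁ x)
    have hsplit' := Finset.sum_filter_add_sum_filter_not s (· ∈ I) (f x)
    have e2 : ∑ w ∈ s with w ∉ I, f₁ x w =
        max 0 (1 - 4 * h x) / max (3 / 4) (1 - h x) * ∑ w ∈ s with w ∉ I, f x w := by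
      rw [Finset.mul_sum]
      exact Finset.sum_congr rfl fun w hw => if_neg (Finset.mem_filter.1 hw).2
    have e1 : ∑ w ∈ s with w ∈ I, f₁ x w = min 1 (4 * h x) := by
      rw [Finset.sum_congr rfl fun w hw =>
        (if_pos (Finset.mem_filter.1 hw).2 : f₁ x w = min 1 (4 * f x w))]
      rcases weightOn_cases hI (hf.2.2 x hx) (hs x hx) with ⟨h0, hw⟩ | ⟨v, hv, hpos, hw, h0⟩
      · rw [Finset.sum_eq_zero fun w hw => by rw [h0 w (Finset.mem_filter.1 hw).2]; simp]
        simp only [h, hw]; simp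
      · simp only [h, hw]
        refine Finset.sum_eq_single v (fun w hw' hne => ?_) fun h' => ?_
        · rw [h0 w (Finset.mem_filter.1 hw').2 hne]; simp
        · exact absurd (Finset.mem_filter.2 ⟨by_contra fun h'' => hpos.ne' (hs x hx v h''), hv⟩) h'
    have e3 : ∑ w ∈ s with w ∉ I, f x w = 1 - h x := by
      simp only [h, weightOn]; linarith
    rw [← hsplit, e1, e2, e3]
    rcases le_total (h x) (1 / 4) with hh | hh
    · rw [min_eq_right (by linarith), max_eq_right (by linarith), max_eq_right (by linarith),
        div_mul_cancel₀ _ (by linarith)]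
      ring
    · rw [min_eq_left (by linarith), max_eq_left (by linarith), zero_div, zero_mul, add_zero]
  have hseg1 : ∀ x ∈ cubeBd (Fin j), ∀ a ∈ Icc (0 : ℝ) 1,
      (fun v => (1 - a) * f x v + a * f₁ x v) ∈ points L := by
    intro x hx a ha
    obtain ⟨h0, t, ht, ht0, ht1⟩ := id (hf.2.2 x hx)
    refine combo_mem_points ht h0 (hf10 x hx) ht0 (fun w hw => hf1s x w (ht0 w hw)) ht1 ?_ ha
    rw [← hsum x hx, Finset.sum_subset (Finset.subset_union_left (s₁ := t) (s₂ := s))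
        fun w _ hw => hf1s x w (ht0 w hw),
      Finset.sum_subset (Finset.subset_union_right (s₁ := t) (s₂ := s))
        fun w _ hw => hf1s x w (hs x hx w hw)]
  have hf1 : FinMap (cubeBd (Fin j)) (fun _ => points L) f₁ := by
    have hh : ContinuousOn h (cubeBd (Fin j)) := continuousOn_weightOn hf.1 s
    refine ⟨fun w => ?_, ⟨s, fun x hx w hw => hf1s x w (hs x hx w hw)⟩, fun x hx => ?_⟩
    · by_cases hw : w ∈ I
      · simp only [f₁, if_pos hw]
        exact continuousOn_const.inf (continuousOn_const.mul (hf.1 w))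
      · simp only [f₁, if_neg hw]
        exact ((continuousOn_const.sup (continuousOn_const.sub (continuousOn_const.mul hh))).div
          (continuousOn_const.sup (continuousOn_const.sub hh)) fun x _ => (hden x).ne').mul (hf.1 w)
    · have := hseg1 x hx 1 (by simp)
      simpa using this
  have hseg2 : ∀ x ∈ cubeBd (Fin j), ∀ a ∈ Icc (0 : ℝ) 1,
      (fun v => (1 - a) * f₁ x v + a * f' x v) ∈ points L := by
    intro x hx a ha
    have hfx := hf.2.2 x hx
    have hf1x := hf1.2.2 x hx
    obtain ⟨hf'x, hf'l⟩ := hf'.2.2 x hx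
    have key : ∀ t ∈ L.faces, (∀ w, w ∉ t → f₁ x w = 0) → (∀ w, w ∉ t → f' x w = 0) →
        (fun v => (1 - a) * f₁ x v + a * f' x v) ∈ points L := fun t ht h1 h2 =>
      combo_mem_points ht (hf10 x hx) hf'x.1 h1 h2 (points_sum_eq_one hf1x h1)
        (points_sum_eq_one hf'x h2) ha
    rcases weightOn_cases hI hfx (hs x hx) with ⟨h0, -⟩ | ⟨v, hv, hpos, hw, h0⟩
    · obtain ⟨-, t, ht, ht0, -⟩ := hfx
      refine key t ht (fun w hw => hf1s x w (ht0 w hw)) fun w hw => ?_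
      rw [hrad x hx fun v hv => by rw [h0 v hv]; norm_num, radial_eq_self h0, ht0 w hw]
    · obtain ⟨-, t, ⟨-, -, ht⟩, ht0, -⟩ := hf'l v hv hpos.ne'
      refine key _ ht (fun w hwt => ?_) fun w hwt =>
        ht0 w fun h' => hwt (Finset.mem_union_right _ h')
      rw [Finset.mem_union, Finset.mem_singleton, not_or] at hwt
      by_cases hwI : w ∈ I
      · exact hf1s x w (h0 w hwI hwt.1)
      simp only [f₁, if_neg hwI]
      -- Below 1/4, `f'` is the radial projection of `f` and has the same support off `I`; from 1/4
      -- on, `f₁` is the vertex `v`, which is joinable to the link point `f'`.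
      rcases lt_or_ge (f x v) (1 / 4) with hlt | hge
      · have h1 := ht0 w hwt.2
        rw [hrad x hx, radial, if_neg hwI, hw, div_eq_zero_iff,
          or_iff_left (by linarith : 1 - f x v ≠ 0)] at h1
        · rw [h1, mul_zero]
        · intro u hu
          by_cases huv : u = v
          · rwa [huv]
          · rw [h0 u hu huv]; norm_num
      · rw [max_eq_left (by simp only [h, hw]; linarith), zero_div, zero_mul]
  obtain ⟨g₁, hg₁, hgf₁⟩ := exists_extension_of_segment hf1 hseg2
    (hg.mono Subset.rfl fun _ _ => points_deletion_subset I) hgf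
  exact exists_extension_of_segment hf hseg1 hg₁ hgf₁

end

/-! ### Barycentric subdivision -/

section

variable {V : Type*} {X : PreAbstractSimplicialComplex V} {σ : Finset V}

open Classical in
/-- The point of the link of `σ` with given coordinates in the barycentric subdivision, the vertex
`τ` of the subdivision standing for the barycenter of `τ \ σ`. -/
noncomputable def bary (σ : Finset V) (T : Finset (Finset V)) (y : Finset V → ℝ) (v : V) : ℝ :=
  ∑ τ ∈ T, if v ∈ τ \ σ then y τ / (τ \ σ).card else 0

open Classical in
/-- The coordinate at `τ` in the barycentric subdivision of the point of the link of `σ` with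
barycentric coordinates `x` supported on `U`. -/
noncomputable def subdivCoord (σ U : Finset V) (x : V → ℝ) (τ : Finset V) : ℝ :=
  if τ ∈ U.powerset.image (σ ∪ ·) then
    (τ \ σ).card * max 0 ((τ \ σ).fold min 1 x - (U \ τ).fold max 0 x) else 0

/-! ### From the link to its subdivision. -/

theorem points_le_one {K : PreAbstractSimplicialComplex V} {y : V → ℝ} (hy : y ∈ points K) (v : V) :
    y v ≤ 1 := by
  obtain ⟨h0, t, -, ht0, ht1⟩ := hy
  by_cases hv : v ∈ t
  · rw [← ht1]
    exact Finset.single_le_sum (fun w _ => h0 w) hv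
  · rw [ht0 v hv]; exact zero_le_one

theorem continuousOn_fold {E : Type*} [TopologicalSpace E] {D : Set E} {F : E → V → ℝ}
    (hF : ∀ v, ContinuousOn (fun x => F x v) D) (op : ℝ → ℝ → ℝ) [Std.Commutative op]
    [Std.Associative op] (hop : Continuous fun p : ℝ × ℝ => op p.1 p.2) (b : ℝ) (s : Finset V) :
    ContinuousOn (fun x => s.fold op b (F x)) D := by
  classical
  induction s using Finset.induction_on with
  | empty => simpa using continuousOn_const
  | insert v s hv ih =>
    simp only [Finset.fold_insert hv]
    exact hop.comp_continuousOn ((hF v).prodMk ih)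

theorem continuousOn_subdivCoord {E : Type*} [TopologicalSpace E] {D : Set E} {F : E → V → ℝ}
    (hF : ∀ v, ContinuousOn (fun x => F x v) D) (U τ : Finset V) :
    ContinuousOn (fun x => subdivCoord σ U (F x) τ) D := by
  by_cases h : τ ∈ U.powerset.image (σ ∪ ·)
  · simp only [subdivCoord, if_pos h]
    exact continuousOn_const.mul (continuousOn_const.sup
      ((continuousOn_fold hF min continuous_min 1 _).sub
        (continuousOn_fold hF max continuous_max 0 _)))
  · simp only [subdivCoord, if_neg h]
    exact continuousOn_const

theorem subdivCoord_nonneg (U : Finset V) (x : V → ℝ) (τ : Finset V) : 0 ≤ subdivCoord σ U x τ := by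
  rw [subdivCoord]
  split_ifs
  exacts [mul_nonneg (Nat.cast_nonneg _) (le_max_left _ _), le_rfl]

-- The subdivision coordinates form the layer-cake decomposition of `x`: a nonzero one at `τ` says
-- that `τ \ σ` is a strict superlevel set of `x`. Superlevel sets are nested, which makes the
-- support a chain.
open Classical in
theorem subdivCoord_ne_zero {U : Finset V} {x : V → ℝ} {τ : Finset V}
    (h : subdivCoord σ U x τ ≠ 0) : σ ⊂ τ ∧ τ ⊆ σ ∪ U ∧
      ∀ u ∈ τ, u ∉ σ → 0 < x u ∧ ∀ w ∈ U, w ∉ τ → x w < x u := by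
  rw [subdivCoord] at h
  split_ifs at h with hτ
  swap; · exact absurd rfl h
  simp only [Finset.mem_image, Finset.mem_powerset] at hτ
  obtain ⟨A, hA, rfl⟩ := hτ
  have hc := left_ne_zero_of_mul h
  have hm := right_ne_zero_of_mul h
  rw [Nat.cast_ne_zero, Finset.card_ne_zero] at hc
  obtain ⟨u, hu⟩ := hc
  rw [Finset.mem_sdiff] at hu
  refine ⟨⟨Finset.subset_union_left, fun h' => hu.2 (h' hu.1)⟩, Finset.union_subset_union_right hA,
    fun u hu hu' => ?_⟩
  have hpos : (U \ (σ ∪ A)).fold max 0 x < ((σ ∪ A) \ σ).fold min 1 x := by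
    by_contra! h'
    exact hm (max_eq_left (by linarith))
  have h1 : ((σ ∪ A) \ σ).fold min 1 x ≤ x u :=
    (Finset.fold_min_le _).2 (Or.inr ⟨u, Finset.mem_sdiff.2 ⟨hu, hu'⟩, le_rfl⟩)
  have h2 := (Finset.fold_max_le _).1 (hpos.le.trans h1)
  refine ⟨lt_of_le_of_lt ((Finset.le_fold_max _).2 (Or.inl le_rfl)) (hpos.trans_le h1),
    fun w hw hw' => ?_⟩
  exact lt_of_le_of_lt ((Finset.le_fold_max _).2 (Or.inr ⟨w, Finset.mem_sdiff.2 ⟨hw, hw'⟩, le_rfl⟩))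
    (hpos.trans_le h1)

/-- The witness is the union of `σ` with the whole support of `x`: the coordinates are positive on
it and vanish outside. -/
theorem sum_subdivCoord_pos {U : Finset V} {x : V → ℝ} (hx : x ∈ points (link X σ))
    (hU : ∀ v, v ∉ U → x v = 0) :
    ∃ τ, 0 < subdivCoord σ U x τ := by
  classical
  let A := U.filter fun v => x v ≠ 0
  have hA : ∀ v, v ∈ A ↔ x v ≠ 0 := fun v =>
    ⟨fun h => (Finset.mem_filter.1 h).2, fun h => Finset.mem_filter.2
      ⟨by_contra fun h' => h (hU v h'), h⟩⟩
  obtain ⟨v, hv⟩ := points_support_nonempty hx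
  have hAf : A ∈ (link X σ).faces := face_of_points hx (fun v h => (hA v).1 h) ⟨v, (hA v).2 hv⟩
  refine ⟨σ ∪ A, ?_⟩
  have hd : (σ ∪ A) \ σ = A := by
    rw [Finset.union_sdiff_left, Finset.sdiff_eq_self_iff_disjoint]
    exact hAf.2.1.symm
  rw [subdivCoord, if_pos (Finset.mem_image_of_mem _ (Finset.mem_powerset.2
    (Finset.filter_subset _ _))), hd]
  refine mul_pos (Nat.cast_pos.2 (Finset.card_pos.2 hAf.1)) (lt_max_of_lt_right (sub_pos.2 ?_))
  refine lt_of_le_of_lt ((Finset.fold_max_le _).2 ⟨le_rfl, fun w hw => ?_⟩)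
    ((Finset.lt_fold_min _).2 ⟨zero_lt_one, fun u hu => ?_⟩)
  · refine (by_contra fun h => ?_ : x w = 0).le
    exact (Finset.mem_sdiff.1 hw).2 (Finset.mem_union_right _ ((hA w).2 h))
  · exact lt_of_le_of_ne (hx.1 u) (Ne.symm ((hA u).1 hu))

/-- Dividing by the sum of the coordinates spares the proof that this sum is 1. -/
theorem normalized_subdivCoord_mem {U : Finset V} {x : V → ℝ} (hx : x ∈ points (link X σ))
    (hU : ∀ v, v ∉ U → x v = 0) {P : Finset (Finset V)}
    (hP : ∀ τ, τ ∉ P → subdivCoord σ U x τ = 0) :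
    0 < ∑ ρ ∈ P, subdivCoord σ U x ρ ∧
    (fun τ => subdivCoord σ U x τ / ∑ ρ ∈ P, subdivCoord σ U x ρ) ∈
      points (chainComplex {t | t ∈ X.faces ∧ σ ⊂ t}) := by
  classical
  obtain ⟨τ₀, hτ₀⟩ := sum_subdivCoord_pos hx hU
  have hmem : τ₀ ∈ P := by_contra fun h => hτ₀.ne' (hP _ h)
  have hpos : 0 < ∑ ρ ∈ P, subdivCoord σ U x ρ := Finset.sum_pos'
    (fun τ _ => subdivCoord_nonneg U x τ) ⟨τ₀, hmem, hτ₀⟩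
  let c := P.filter fun τ => subdivCoord σ U x τ ≠ 0
  have hc : ∀ τ, τ ∈ c ↔ subdivCoord σ U x τ ≠ 0 := fun τ =>
    ⟨fun h => (Finset.mem_filter.1 h).2, fun h => Finset.mem_filter.2
      ⟨by_contra fun h' => h (hP τ h'), h⟩⟩
  refine ⟨hpos, fun τ => div_nonneg (subdivCoord_nonneg U x τ) hpos.le, c,
    ⟨⟨τ₀, (hc _).2 hτ₀.ne'⟩, fun τ hτ => ?_, fun τ hτ ρ hρ _ => ?_⟩, fun τ hτ => ?_, ?_⟩
  · obtain ⟨h1, h2, h3⟩ := subdivCoord_ne_zero ((hc τ).1 hτ)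
    refine ⟨?_, h1⟩
    have hf : τ \ σ ∈ (link X σ).faces := by
      refine face_of_points hx (fun v hv => ?_) (Finset.sdiff_nonempty.2 h1.2)
      rw [Finset.mem_sdiff] at hv
      exact (h3 v hv.1 hv.2).1.ne'
    have := hf.2.2
    rwa [Finset.union_sdiff_of_subset h1.1] at this
  · obtain ⟨h1, h2, h3⟩ := subdivCoord_ne_zero ((hc τ).1 hτ)
    obtain ⟨h1', h2', h3'⟩ := subdivCoord_ne_zero ((hc ρ).1 hρ)
    by_contra h
    rw [not_or] at h
    obtain ⟨u, hu, hu'⟩ := Finset.not_subset.1 h.1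
    obtain ⟨w, hw, hw'⟩ := Finset.not_subset.1 h.2
    have huσ : u ∉ σ := fun h => hu' (h1'.1 h)
    have hwσ : w ∉ σ := fun h => hw' (h1.1 h)
    have huU := (Finset.mem_union.1 (h2 hu)).resolve_left huσ
    have hwU := (Finset.mem_union.1 (h2' hw)).resolve_left hwσ
    exact lt_asymm ((h3 u hu huσ).2 w hwU hw') ((h3' w hw hwσ).2 u huU hu')
  · have : subdivCoord σ U x τ = 0 := by_contra fun h => hτ ((hc τ).2 h)
    simp only [this, zero_div]
  · rw [← Finset.sum_div, div_eq_one_iff_eq hpos.ne']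
    refine Finset.sum_subset (Finset.filter_subset _ _) fun τ _ hτ => by_contra fun h => hτ ((hc τ).2 h)

/-! ### From the subdivision to the link, and back. -/

section

variable {T : Finset (Finset V)} {y : Finset V → ℝ}

open Classical in
theorem bary_coeff_nonneg (hy : ∀ τ, 0 ≤ y τ) (τ : Finset V) : 0 ≤ y τ / ((τ \ σ).card : ℝ) :=
  div_nonneg (hy τ) (Nat.cast_nonneg _)

open Classical in
theorem bary_le_sum (hy : ∀ τ, 0 ≤ y τ) (p : Finset V → Prop) [DecidablePred p] {v : V}
    (h : ∀ ρ, y ρ ≠ 0 → v ∈ ρ → v ∉ σ → p ρ) :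
    bary σ T y v ≤ ∑ τ ∈ T, if p τ then y τ / (τ \ σ).card else 0 := by
  refine Finset.sum_le_sum fun ρ _ => ?_
  by_cases hρ : y ρ = 0
  · simp [hρ]
  split_ifs with h1 h2
  · exact le_rfl
  · rw [Finset.mem_sdiff] at h1
    exact absurd (h ρ hρ h1.1 h1.2) h2
  · exact bary_coeff_nonneg hy ρ
  · exact le_rfl

open Classical in
theorem sum_le_bary (hy : ∀ τ, 0 ≤ y τ) (p : Finset V → Prop) [DecidablePred p] {v : V}
    (h : ∀ ρ, y ρ ≠ 0 → p ρ → v ∈ ρ ∧ v ∉ σ) :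
    (∑ τ ∈ T, if p τ then y τ / (τ \ σ).card else 0) ≤ bary σ T y v := by
  refine Finset.sum_le_sum fun ρ _ => ?_
  by_cases hρ : y ρ = 0
  · simp [hρ]
  split_ifs with h1 h2
  · exact le_rfl
  · exact absurd (Finset.mem_sdiff.2 (h ρ hρ h1)) h2
  · exact bary_coeff_nonneg hy ρ
  · exact le_rfl

theorem bary_le_bary (hy : ∀ τ, 0 ≤ y τ) {u w : V}
    (h : ∀ ρ, y ρ ≠ 0 → u ∈ ρ → u ∉ σ → w ∈ ρ ∧ w ∉ σ) : bary σ T y u ≤ bary σ T y w := by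
  classical
  exact (bary_le_sum hy (fun ρ => w ∈ ρ \ σ) fun ρ h1 h2 h3 =>
    Finset.mem_sdiff.2 (h ρ h1 h2 h3)).trans_eq (Finset.sum_congr rfl fun _ _ => by congr)

theorem bary_pos (hy : ∀ τ, 0 ≤ y τ) (hT : ∀ τ, τ ∉ T → y τ = 0) {τ : Finset V} (hτ : y τ ≠ 0)
    {v : V} (hv : v ∈ τ) (hv' : v ∉ σ) : 0 < bary σ T y v := by
  classical
  refine Finset.sum_pos' (fun ρ _ => ?_) ⟨τ, by_contra fun h => hτ (hT τ h), ?_⟩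
  · split_ifs
    exacts [bary_coeff_nonneg hy ρ, le_rfl]
  · have hm : v ∈ τ \ σ := Finset.mem_sdiff.2 ⟨hv, hv'⟩
    rw [if_pos hm]
    exact div_pos (lt_of_le_of_ne (hy τ) (Ne.symm hτ)) (Nat.cast_pos.2 (Finset.card_pos.2 ⟨v, hm⟩))

theorem chain_of_points {S : Set (Finset V)} (hy : y ∈ points (chainComplex S)) {τ ρ : Finset V}
    (hτ : y τ ≠ 0) (hρ : y ρ ≠ 0) : τ ⊆ ρ ∨ ρ ⊆ τ := by
  obtain ⟨-, c, ⟨-, -, hc⟩, hc0, -⟩ := hy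
  exact hc.total (by_contra fun h => hτ (hc0 τ h)) (by_contra fun h => hρ (hc0 ρ h))

theorem mem_of_points {S : Set (Finset V)} (hy : y ∈ points (chainComplex S)) {τ : Finset V}
    (hτ : y τ ≠ 0) : τ ∈ S := by
  obtain ⟨-, c, ⟨-, hS, -⟩, hc0, -⟩ := hy
  exact hS (by_contra fun h => hτ (hc0 τ h))

/-- A set comparable with all sets of the chain supporting `y` has a member lying in no smaller set
of that chain. -/
theorem exists_mem_new (hy : y ∈ points (chainComplex {t | t ∈ X.faces ∧ σ ⊂ t}))
    (hT : ∀ τ, τ ∉ T → y τ = 0) {τ : Finset V} (hτ : σ ⊂ τ)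
    (hcomp : ∀ ρ, y ρ ≠ 0 → ρ ⊆ τ ∨ τ ⊆ ρ) :
    ∃ u ∈ τ, u ∉ σ ∧ ∀ ρ, y ρ ≠ 0 → u ∈ ρ → τ ⊆ ρ := by
  classical
  rcases (T.filter fun ρ => y ρ ≠ 0 ∧ ρ ⊂ τ).eq_empty_or_nonempty with h | h
  · obtain ⟨u, hu, hu'⟩ := Finset.not_subset.1 hτ.2
    refine ⟨u, hu, hu', fun ρ hρ _ => (hcomp ρ hρ).elim (fun h' => ?_) id⟩
    by_contra hne
    exact Finset.notMem_empty ρ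
      (h ▸ Finset.mem_filter.2 ⟨by_contra fun h'' => hρ (hT ρ h''), hρ, h', hne⟩)
  · obtain ⟨ρ₀, hρ₀, hmax⟩ := Finset.exists_max_image _ Finset.card h
    obtain ⟨-, hy0, hsub⟩ := Finset.mem_filter.1 hρ₀
    obtain ⟨u, hu, hu'⟩ := Finset.not_subset.1 hsub.2
    refine ⟨u, hu, fun h' => hu' ((mem_of_points hy hy0).2.1 h'),
      fun ρ hρ huρ => (hcomp ρ hρ).elim (fun h' => ?_) id⟩
    by_contra hne
    have hle := hmax ρ (Finset.mem_filter.2 ⟨by_contra fun h'' => hρ (hT ρ h''), hρ, h', hne⟩)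
    rcases chain_of_points hy hρ hy0 with h1 | h1
    · exact hu' (h1 huρ)
    · exact hu' (Finset.eq_of_subset_of_card_le h1 hle ▸ huρ)

theorem exists_mem_next (hy : y ∈ points (chainComplex {t | t ∈ X.faces ∧ σ ⊂ t}))
    (hT : ∀ τ, τ ∉ T → y τ = 0) (τ : Finset V) :
    (∀ ρ, y ρ ≠ 0 → ¬ τ ⊂ ρ) ∨
      ∃ w, w ∉ τ ∧ (∃ ρ, y ρ ≠ 0 ∧ w ∈ ρ) ∧ ∀ ρ, y ρ ≠ 0 → τ ⊂ ρ → w ∈ ρ := by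
  classical
  rcases (T.filter fun ρ => y ρ ≠ 0 ∧ τ ⊂ ρ).eq_empty_or_nonempty with h | h
  · exact Or.inl fun ρ hρ h' => Finset.notMem_empty ρ
      (h ▸ Finset.mem_filter.2 ⟨by_contra fun h'' => hρ (hT ρ h''), hρ, h'⟩)
  · right
    obtain ⟨ρ₀, hρ₀, hmin⟩ := Finset.exists_min_image _ Finset.card h
    obtain ⟨-, hy0, hsub⟩ := Finset.mem_filter.1 hρ₀
    obtain ⟨w, hw, hw'⟩ := Finset.not_subset.1 hsub.2
    refine ⟨w, hw', ⟨ρ₀, hy0, hw⟩, fun ρ hρ h' => ?_⟩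
    have hle := hmin ρ (Finset.mem_filter.2 ⟨by_contra fun h'' => hρ (hT ρ h''), hρ, h'⟩)
    rcases chain_of_points hy hy0 hρ with h1 | h1
    · exact h1 hw
    · exact Finset.eq_of_subset_of_card_le h1 hle ▸ hw

/-- The support of `y` is a chain with a largest member `M`, and all barycenters involved lie in the
simplex `M \ σ`. -/
theorem bary_mem (hy : y ∈ points (chainComplex {t | t ∈ X.faces ∧ σ ⊂ t}))
    (hT : ∀ τ, τ ∉ T → y τ = 0) : bary σ T y ∈ points (link X σ) := by
  classical
  have h0 := hy.1
  have hne : (T.filter fun ρ => y ρ ≠ 0).Nonempty := by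
    obtain ⟨τ, hτ⟩ := points_support_nonempty hy
    exact ⟨τ, Finset.mem_filter.2 ⟨by_contra fun h => hτ (hT τ h), hτ⟩⟩
  obtain ⟨M, hM, hmax⟩ := Finset.exists_max_image _ Finset.card hne
  obtain ⟨-, hyM⟩ := Finset.mem_filter.1 hM
  have hle : ∀ ρ, y ρ ≠ 0 → ρ ⊆ M := by
    intro ρ hρ
    have hc := hmax ρ (Finset.mem_filter.2 ⟨by_contra fun h'' => hρ (hT ρ h''), hρ⟩)
    rcases chain_of_points hy hρ hyM with h1 | h1
    · exact h1
    · exact (Finset.eq_of_subset_of_card_le h1 hc).ge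
  obtain ⟨hMX, hσM⟩ := mem_of_points hy hyM
  refine ⟨fun v => Finset.sum_nonneg fun ρ _ => ?_, M \ σ,
    ⟨Finset.sdiff_nonempty.2 hσM.2, Finset.disjoint_sdiff, ?_⟩, fun v hv => ?_, ?_⟩
  · split_ifs
    exacts [bary_coeff_nonneg h0 ρ, le_rfl]
  · rwa [Finset.union_sdiff_of_subset hσM.1]
  · refine Finset.sum_eq_zero fun ρ _ => ?_
    by_cases hρ : y ρ = 0
    · simp [hρ]
    · exact if_neg fun h => hv (Finset.sdiff_subset_sdiff (hle ρ hρ) le_rfl h)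
  · simp only [bary]
    rw [Finset.sum_comm, ← points_sum_eq_one hy hT]
    refine Finset.sum_congr rfl fun ρ _ => ?_
    by_cases hρ : y ρ = 0
    · simp [hρ]
    · rw [← Finset.sum_filter, Finset.filter_mem_eq_inter,
        Finset.inter_eq_right.2 (Finset.sdiff_subset_sdiff (hle ρ hρ) le_rfl),
        Finset.sum_const, nsmul_eq_mul, mul_div_cancel₀]
      exact Nat.cast_ne_zero.2 (Finset.card_ne_zero.2
        (Finset.sdiff_nonempty.2 (mem_of_points hy hρ).2.2))

/-- Along the chain supporting `y`, the barycentric coordinates drop exactly where a member ends,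
and the drop at `τ` is `y τ / |τ \ σ|`. The starting values 1 and 0 of the folds are harmless, since
all coordinates lie in [0, 1]. -/
theorem subdivCoord_bary (hy : y ∈ points (chainComplex {t | t ∈ X.faces ∧ σ ⊂ t}))
    (hT : ∀ τ, τ ∉ T → y τ = 0) {U : Finset V} (hU : ∀ v, v ∉ U → bary σ T y v = 0)
    (τ : Finset V) : subdivCoord σ U (bary σ T y) τ = y τ := by
  classical
  have h0 := hy.1
  have hx := bary_mem hy hT
  have hmemU : ∀ ρ, y ρ ≠ 0 → ∀ v ∈ ρ, v ∉ σ → v ∈ U := fun ρ hρ v hv hv' =>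
    by_contra fun h => (bary_pos h0 hT hρ hv hv').ne' (hU v h)
  by_cases hτ : y τ = 0
  -- A nonzero coordinate would make `τ` a strict superlevel set. Yet some `u` in `τ` has no larger
  -- coordinate than a `w` outside, since every chain member containing `u` contains `w`; if `τ` is
  -- comparable with the whole chain and no member is larger, the coordinate of `u` is 0.
  · by_contra hne
    rw [hτ] at hne
    obtain ⟨h1, h2, h3⟩ := subdivCoord_ne_zero hne
    by_cases hcomp : ∀ ρ, y ρ ≠ 0 → ρ ⊆ τ ∨ τ ⊆ ρ
    · obtain ⟨u, hu, huσ, hnew⟩ := exists_mem_new hy hT h1 hcomp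
      have hss : ∀ ρ, y ρ ≠ 0 → u ∈ ρ → τ ⊂ ρ := fun ρ hρ huρ =>
        (hnew ρ hρ huρ).ssubset_of_ne fun h => hρ (h ▸ hτ)
      rcases exists_mem_next hy hT τ with hn | ⟨w, hw, ⟨ρ, hρ, hwρ⟩, hn⟩
      · refine (h3 u hu huσ).1.ne' (Finset.sum_eq_zero fun ρ _ => ?_)
        by_cases hρ : y ρ = 0
        · simp [hρ]
        · exact if_neg fun h => hn ρ hρ (hss ρ hρ (Finset.mem_sdiff.1 h).1)
      · have hwσ : w ∉ σ := fun h => hw (h1.1 h)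
        refine ((h3 u hu huσ).2 w (hmemU ρ hρ w hwρ hwσ) hw).not_ge (bary_le_bary h0 ?_)
        exact fun ρ hρ huρ _ => ⟨hn ρ hρ (hss ρ hρ huρ), hwσ⟩
    · push Not at hcomp
      obtain ⟨ρ, hρ, hn1, hn2⟩ := hcomp
      obtain ⟨w, hw, hwτ⟩ := Finset.not_subset.1 hn1
      obtain ⟨u, hu, huρ⟩ := Finset.not_subset.1 hn2
      have hwσ : w ∉ σ := fun h => hwτ (h1.1 h)
      have huσ : u ∉ σ := fun h => huρ ((mem_of_points hy hρ).2.1 h)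
      refine ((h3 u hu huσ).2 w (hmemU ρ hρ w hw hwσ) hwτ).not_ge (bary_le_bary h0 ?_)
      intro ρ' hρ' hu' _
      rcases chain_of_points hy hρ hρ' with h | h
      · exact ⟨h hw, hwσ⟩
      · exact absurd (h hu') huρ
  · obtain ⟨-, hσ⟩ := mem_of_points hy hτ
    have hP : τ ∈ U.powerset.image (σ ∪ ·) := by
      refine Finset.mem_image.2 ⟨τ \ σ, Finset.mem_powerset.2 fun v hv => ?_,
        Finset.union_sdiff_of_subset hσ.1⟩
      rw [Finset.mem_sdiff] at hv
      exact hmemU τ hτ v hv.1 hv.2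
    have hcard : ((τ \ σ).card : ℝ) ≠ 0 :=
      Nat.cast_ne_zero.2 (Finset.card_ne_zero.2 (Finset.sdiff_nonempty.2 hσ.2))
    set a := y τ / ((τ \ σ).card : ℝ) with ha
    have ha0 : 0 ≤ a := bary_coeff_nonneg h0 τ
    -- `B` is the largest value outside `τ` and `B + a` the smallest on `τ \ σ`; their difference
    -- `a` is the layer belonging to `τ`.
    set B := ∑ ρ ∈ T, if τ ⊂ ρ then y ρ / ((ρ \ σ).card : ℝ) else 0 with hB
    have hB0 : 0 ≤ B := Finset.sum_nonneg fun ρ _ => by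
      split_ifs
      exacts [bary_coeff_nonneg h0 ρ, le_rfl]
    have hBa : (∑ ρ ∈ T, if τ ⊆ ρ then y ρ / ((ρ \ σ).card : ℝ) else 0) = B + a := by
      have : a = ∑ ρ ∈ T, if ρ = τ then y ρ / ((ρ \ σ).card : ℝ) else 0 := by
        rw [Finset.sum_ite_eq', if_pos (by_contra fun h => hτ (hT τ h))]
      rw [this, hB, ← Finset.sum_add_distrib]
      refine Finset.sum_congr rfl fun ρ _ => ?_
      by_cases h1 : ρ = τ
      · subst h1; simp
      · by_cases h2 : τ ⊆ ρ
        · rw [if_pos h2, if_pos (h2.ssubset_of_ne (Ne.symm h1)), if_neg h1, add_zero]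
        · rw [if_neg h2, if_neg (fun h => h2 h.1), if_neg h1, add_zero]
    have hmin : (τ \ σ).fold min 1 (bary σ T y) = B + a := by
      obtain ⟨u, hu, huσ, hnew⟩ := exists_mem_new hy hT hσ
        (fun ρ hρ => chain_of_points hy hρ hτ)
      have hge : ∀ v ∈ τ \ σ, B + a ≤ bary σ T y v := by
        intro v hv
        rw [← hBa]
        exact sum_le_bary h0 (τ ⊆ ·) fun ρ hρ hτρ =>
          ⟨hτρ (Finset.mem_sdiff.1 hv).1, (Finset.mem_sdiff.1 hv).2⟩
      have hu' : u ∈ τ \ σ := Finset.mem_sdiff.2 ⟨hu, huσ⟩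
      refine le_antisymm ((Finset.fold_min_le _).2 (Or.inr ⟨u, hu', ?_⟩))
        ((Finset.le_fold_min _).2 ⟨(hge u hu').trans (points_le_one hx u), hge⟩)
      rw [← hBa]
      exact bary_le_sum h0 (τ ⊆ ·) fun ρ hρ huρ _ => hnew ρ hρ huρ
    have hmax : (U \ τ).fold max 0 (bary σ T y) = B := by
      refine le_antisymm ((Finset.fold_max_le _).2 ⟨hB0, fun w hw => ?_⟩) ?_
      · refine bary_le_sum h0 (τ ⊂ ·) fun ρ hρ hwρ _ => ?_
        rcases chain_of_points hy hτ hρ with h | h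
        · exact ⟨h, fun h' => (Finset.mem_sdiff.1 hw).2 (h' hwρ)⟩
        · exact absurd (h hwρ) (Finset.mem_sdiff.1 hw).2
      · refine (Finset.le_fold_max _).2 ?_
        rcases exists_mem_next hy hT τ with hn | ⟨w, hw, ⟨ρ, hρ, hwρ⟩, hn⟩
        · refine Or.inl (Finset.sum_eq_zero fun ρ _ => ?_).le
          by_cases hρ : y ρ = 0
          · simp [hρ]
          · exact if_neg (hn ρ hρ)
        · have hwσ : w ∉ σ := fun h => hw (hσ.1 h)
          exact Or.inr ⟨w, Finset.mem_sdiff.2 ⟨hmemU ρ hρ w hwρ hwσ, hw⟩,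
            sum_le_bary h0 (τ ⊂ ·) fun ρ hρ hτρ => ⟨hn ρ hρ hτρ, hwσ⟩⟩
    rw [subdivCoord, if_pos hP, hmin, hmax, add_sub_cancel_left, max_eq_right ha0, ha,
      mul_div_cancel₀ _ hcard]

end

/-- The poset of simplices properly containing `σ` is as connected as the link of `σ`. -/
theorem conn_supersets {k : ℤ} (h : Conn k (link X σ)) :
    Conn k (chainComplex {t | t ∈ X.faces ∧ σ ⊂ t}) := by
  classical
  intro j hj f hf
  obtain ⟨T, hT⟩ := hf.2.1
  have hb : FinMap (cubeBd (Fin j)) (fun _ => points (link X σ)) fun x => bary σ T (f x) := by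
    refine ⟨fun v => continuousOn_finsetSum _ fun τ _ => ?_, ⟨T.sup id, fun x _ v hv => ?_⟩,
      fun x hx => bary_mem (hf.2.2 x hx) (hT x hx)⟩
    · split_ifs
      exacts [(hf.1 τ).div_const _, continuousOn_const]
    · refine Finset.sum_eq_zero fun τ hτ => if_neg fun h' => hv ?_
      exact Finset.mem_sup.2 ⟨τ, hτ, (Finset.mem_sdiff.1 h').1⟩
  -- Only a retraction is needed: fill the barycentric image in the link, then return by
  -- `subdivCoord`, which restores `f` on the boundary.
  obtain ⟨g, hg, hgf⟩ := h j hj _ hb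
  obtain ⟨U, hU⟩ := hg.2.1
  let P := U.powerset.image (σ ∪ ·)
  have hP : ∀ x τ, τ ∉ P → subdivCoord σ U x τ = 0 := fun x τ hτ => if_neg hτ
  have hmem := fun x hx => normalized_subdivCoord_mem (hg.2.2 x hx) (hU x hx) (hP (g x))
  refine ⟨fun x τ => subdivCoord σ U (g x) τ / ∑ ρ ∈ P, subdivCoord σ U (g x) ρ,
    ⟨fun τ => ?_, ⟨P, fun x _ τ hτ => ?_⟩, fun x hx => (hmem x hx).2⟩, fun x hx => ?_⟩
  · exact (continuousOn_subdivCoord hg.1 U τ).div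
      (continuousOn_finsetSum _ fun ρ _ => continuousOn_subdivCoord hg.1 U ρ)
      fun x hx => (hmem x hx).1.ne'
  · simp only [hP (g x) τ hτ, zero_div]
  · have h1 : ∀ τ, subdivCoord σ U (g x) τ = f x τ := by
      have hgx := hgf hx
      have hUx := hU x hx.1
      simp only at hgx
      rw [hgx] at hUx ⊢
      exact subdivCoord_bary (hf.2.2 x hx) (hT x hx) hUx
    have h2 : ∑ ρ ∈ P, subdivCoord σ U (g x) ρ = 1 := by
      rw [Finset.sum_congr rfl fun ρ _ => h1 ρ]
      exact points_sum_eq_one (hf.2.2 x hx) fun τ hτ => (h1 τ) ▸ hP _ τ hτ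
    funext τ
    beta_reduce
    rw [h2, h1, div_one]

end

/-! ### Order complexes -/

section

variable {P : Type*} [PartialOrder P]

theorem Conn.chain_congr {k l : ℤ} {S S' : Set P} (h : Conn k (chainComplex S)) (hk : l = k)
    (hS : ∀ x, x ∈ S' ↔ x ∈ S) : Conn l (chainComplex S') := by
  rw [hk, Set.ext hS]
  exact h

theorem deletion_chainComplex (S I : Set P) :
    deletion (chainComplex S) I = chainComplex (S \ I) := by
  ext c
  constructor
  · rintro ⟨⟨h1, h2, h3⟩, h4⟩
    exact ⟨h1, fun x hx => ⟨h2 hx, h4 x hx⟩, h3⟩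
  · rintro ⟨h1, h2, h3⟩
    exact ⟨⟨h1, fun x hx => (h2 hx).1, h3⟩, fun x hx => (h2 hx).2⟩

theorem link_chainComplex {S : Set P} {c : Finset P} (hc : c ∈ (chainComplex S).faces) :
    link (chainComplex S) c = chainComplex {x | x ∈ S ∧ x ∉ c ∧ ∀ y ∈ c, x ≤ y ∨ y ≤ x} := by
  classical
  obtain ⟨-, hcS, hcc⟩ := hc
  ext t
  constructor
  · rintro ⟨hn, hd, -, hS, hch⟩
    have ht : ∀ x ∈ t, x ∈ c ∪ t := fun x hx => Finset.mem_union_right _ hx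
    refine ⟨hn, fun x hx => ⟨hS (ht x hx), fun h => Finset.disjoint_left.1 hd h hx,
      fun y hy => hch.total (ht x hx) (Finset.mem_union_left _ hy)⟩, hch.mono ht⟩
  · rintro ⟨hn, hS, hch⟩
    refine ⟨hn, Finset.disjoint_left.2 fun x hx hxt => (hS hxt).2.1 hx,
      hn.mono Finset.subset_union_right, fun x hx => ?_, fun x hx y hy hne => ?_⟩
    · rcases Finset.mem_union.1 hx with h | h
      exacts [hcS h, (hS h).1]
    · rcases Finset.mem_union.1 hx with h | h <;> rcases Finset.mem_union.1 hy with h' | h'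
      exacts [hcc h h' hne, ((hS h').2.2 x h).symm, (hS h).2.2 y h', hch h h' hne]

theorem link_chainComplex_singleton {S : Set P} {v : P} (hv : v ∈ S) :
    link (chainComplex S) {v} = chainComplex {x | x ∈ S ∧ (x < v ∨ v < x)} := by
  have hc : ({v} : Finset P) ∈ (chainComplex S).faces := ⟨by simp, by simpa using hv, by simp⟩
  rw [link_chainComplex hc]
  congr 1
  ext x
  simp only [mem_ofPred_eq, Finset.mem_singleton, forall_eq, lt_iff_le_and_ne]
  refine and_congr_right fun _ => ?_
  have : x ≠ v ↔ v ≠ x := ne_comm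
  tauto

theorem independent_chainComplex {S I : Set P} (hI : IsAntichain (· ≤ ·) I) :
    Independent (chainComplex S) I := by
  rintro t ⟨-, -, hc⟩ v hv w hw hvI hwI
  by_contra hne
  rcases hc hv hw hne with h | h
  exacts [hI hvI hwI hne h, hI hwI hvI (Ne.symm hne) h]

theorem conn_sdiff_antichain {k : ℤ} {S I : Set P} (hI : IsAntichain (· ≤ ·) I)
    (hS : Conn k (chainComplex S))
    (hlink : ∀ v ∈ S, v ∈ I → Conn k (chainComplex {x | x ∈ S ∧ (x < v ∨ v < x)})) :
    Conn k (chainComplex (S \ I)) := by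
  rw [← deletion_chainComplex]
  refine conn_deletion (independent_chainComplex hI) hS fun v hv hvS => ?_
  have hvS' : v ∈ S := hvS.2.1 (by simp)
  rw [link_chainComplex_singleton hvS']
  exact hlink v hvS' hv

theorem conn_of_sdiff_antichain {k : ℤ} {S I : Set P} (hI : IsAntichain (· ≤ ·) I)
    (hS : Conn k (chainComplex (S \ I)))
    (hlink : ∀ v ∈ S, v ∈ I → Conn (k - 1) (chainComplex {x | x ∈ S ∧ (x < v ∨ v < x)})) :
    Conn k (chainComplex S) := by
  rw [← deletion_chainComplex] at hS
  refine conn_of_deletion (independent_chainComplex hI) hS fun v hv hvS => ?_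
  have hvS' : v ∈ S := hvS.2.1 (by simp)
  rw [link_chainComplex_singleton hvS']
  exact hlink v hvS' hv

/-- An element comparable with all others extends every chain, so the order complex is a cone. -/
theorem conn_of_comparable {S : Set P} {v : P} (hv : v ∈ S) (h : ∀ x ∈ S, x ≤ v ∨ v ≤ x) (k : ℤ) :
    Conn k (chainComplex S) := by
  classical
  have hv' : ({v} : Finset P) ∈ (chainComplex S).faces := ⟨by simp, by simpa using hv, by simp⟩
  refine conn_of_cone v hv' (fun t ht => ?_) k
  obtain ⟨-, hS, hc⟩ := ht
  refine ⟨insert v t, ⟨by simp, ?_, ?_⟩, Finset.subset_insert _ _, Finset.mem_insert_self _ _⟩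
  · rw [Finset.coe_insert]
    exact insert_subset hv hS
  · rw [Finset.coe_insert]
    exact hc.insert fun x hx _ => (h x (hS hx)).symm

end

/-! ### Truncated Boolean lattices and the main theorem -/

section

variable {V : Type*}

theorem isAntichain_of_card_eq {I : Set (Finset V)} {m : ℕ} (h : ∀ s ∈ I, s.card = m) :
    IsAntichain (· ≤ ·) I := fun s hs t ht hne hle =>
  hne (Finset.eq_of_subset_of_card_le hle ((h t ht).trans (h s hs).symm).le)

/-- The join of a `k`-connected poset with an open interval of the lattice of finite sets. -/
theorem conn_openInterval_union {k : ℤ} (n : ℕ) : ∀ {A D : Finset V}, A ⊂ D →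
    D.card = A.card + n + 1 → ∀ {Y : Set (Finset V)}, (∀ t ∈ Y, D ⊆ t) → Conn k (chainComplex Y) →
    Conn (k + n) (chainComplex ({s | A ⊂ s ∧ s ⊂ D} ∪ Y)) := by
  classical
  induction n with
  | zero =>
    intro A D hAD hcard Y hY hk
    have : {s | A ⊂ s ∧ s ⊂ D} = ∅ := by
      refine eq_empty_of_forall_notMem fun s hs => ?_
      have h1 := Finset.card_lt_card hs.1
      have h2 := Finset.card_lt_card hs.2
      omega
    rw [this, empty_union]
    simpa using hk
  | succ n ih =>
    intro A D hAD hcard Y hY hk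
    -- Without the coatom `D.erase v` the poset is contractible. The sets containing `v`, together
    -- with `Y`, form a cone over `insert v A`; sets `s` avoiding `v` are added by increasing size,
    -- and each has a link that is a cone over `insert v s`.
    obtain ⟨v, hvD, hvA⟩ := Finset.not_subset.1 hAD.2
    have hYD : ∀ s, s ⊂ D → s ∉ Y := fun s hs hsY => hs.2 (hY s hsY)
    have hlow : ∀ i ≤ n, ∀ l, Conn l (chainComplex
        ({s | A ⊂ s ∧ s ⊂ D ∧ (v ∈ s ∨ s.card ≤ A.card + i)} ∪ Y)) := by
      intro i
      induction i with
      | zero =>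
        intro _ l
        have hc : (insert v A).card = A.card + 1 := Finset.card_insert_of_notMem hvA
        have hlt : insert v A ⊂ D := (Finset.insert_subset hvD hAD.1).ssubset_of_ne fun h => by
          rw [h] at hc; omega
        refine conn_of_comparable (v := insert v A) (Or.inl ⟨Finset.ssubset_insert hvA, hlt,
          Or.inl (Finset.mem_insert_self _ _)⟩) ?_ l
        · rintro x (⟨h1, h2, h3⟩ | hx)
          · right
            refine Finset.insert_subset (h3.resolve_right fun h => ?_) h1.1
            have := Finset.card_lt_card h1
            omega
          · exact Or.inr ((Finset.insert_subset hvD hAD.1).trans (hY x hx))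
      | succ i ihi =>
        intro hi l
        refine conn_of_sdiff_antichain
          (I := {s | v ∉ s ∧ s ⊂ D ∧ s.card = A.card + (i + 1)})
          (isAntichain_of_card_eq fun s hs => hs.2.2) ?_ ?_
        · refine (ihi (by omega) l).chain_congr rfl fun s => ?_
          simp only [mem_sdiff, mem_union, mem_ofPred_eq]
          constructor
          · rintro ⟨⟨h1, h2, h3⟩ | h, h4⟩
            · refine Or.inl ⟨h1, h2, ?_⟩
              by_cases hv : v ∈ s
              · exact Or.inl hv
              · refine Or.inr ?_
                have := h3.resolve_left hv
                have : s.card ≠ A.card + (i + 1) := fun h => h4 ⟨hv, h2, h⟩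
                omega
            · exact Or.inr h
          · rintro (⟨h1, h2, h3⟩ | h)
            · refine ⟨Or.inl ⟨h1, h2, h3.imp_right fun h => by omega⟩, fun h4 => ?_⟩
              have := h3.resolve_left h4.1
              omega
            · exact ⟨Or.inr h, fun h4 => hYD s h4.2.1 h⟩
        · rintro s hs ⟨hvs, hsD, hsc⟩
          obtain ⟨hAs, -, -⟩ := hs.resolve_right (hYD s hsD)
          have hc : (insert v s).card = s.card + 1 := Finset.card_insert_of_notMem hvs
          have hsub : insert v s ⊆ D := Finset.insert_subset hvD hsD.1
          refine conn_of_comparable (v := insert v s) (mem_ofPred.2 ⟨Or.inl ⟨hAs.trans (Finset.ssubset_insert hvs),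
            hsub.ssubset_of_ne fun h => by rw [h] at hc; omega,
            Or.inl (Finset.mem_insert_self _ _)⟩, Or.inr (Finset.ssubset_insert hvs)⟩) ?_ _
          rintro x ⟨hx, hlt | hlt⟩
          · exact Or.inl (hlt.le.trans (Finset.subset_insert _ _))
          · right
            rcases hx with ⟨-, -, h3⟩ | hx
            · refine Finset.insert_subset (h3.resolve_right fun h => ?_) hlt.le
              have := Finset.card_lt_card hlt
              omega
            · exact hsub.trans (hY x hx)
    -- Adding the coatom raises connectivity to one more than that of its link, the same kind of
    -- poset for the shorter interval from `A` to `D.erase v`.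
    have hF : D.erase v ⊂ D := Finset.erase_ssubset hvD
    have hFc : (D.erase v).card = A.card + n + 1 := by
      rw [Finset.card_erase_of_mem hvD, hcard]; rfl
    have hAF : A ⊂ D.erase v := (Finset.subset_erase.2 ⟨hAD.1, hvA⟩).ssubset_of_ne fun h => by
      rw [← h] at hFc; omega
    refine conn_of_sdiff_antichain (I := {D.erase v}) (isAntichain_of_card_eq (m := A.card + n + 1)
      (by simpa using hFc)) ?_ ?_
    · refine (hlow n le_rfl (k + (n + 1 : ℕ))).chain_congr rfl fun s => ?_
      simp only [mem_sdiff, mem_union, mem_ofPred_eq, mem_singleton_iff]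
      constructor
      · rintro ⟨⟨h1, h2⟩ | h, h4⟩
        · refine Or.inl ⟨h1, h2, ?_⟩
          by_cases hv : v ∈ s
          · exact Or.inl hv
          · have := Finset.card_lt_card
              ((Finset.subset_erase.2 ⟨h2.1, hv⟩).ssubset_of_ne h4)
            exact Or.inr (by omega)
        · exact Or.inr h
      · rintro (⟨h1, h2, h3⟩ | h)
        · refine ⟨Or.inl ⟨h1, h2⟩, ?_⟩
          rintro rfl
          rcases h3 with h3 | h3
          · exact Finset.notMem_erase v D h3
          · omega
        · exact ⟨Or.inr h, by rintro rfl; exact hYD _ hF h⟩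
    · rintro s - rfl
      refine (ih hAF hFc (fun t ht => hF.1.trans (hY t ht)) hk).chain_congr
        (by push_cast; ring) fun x => ?_
      simp only [mem_union, mem_ofPred_eq]
      constructor
      · rintro ⟨⟨h1, h2⟩ | h, hlt | hlt⟩
        · exact Or.inl ⟨h1, hlt⟩
        · have h3 := Finset.card_lt_card hlt
          have h4 := Finset.card_lt_card h2
          omega
        · exact Or.inr h
        · exact Or.inr h
      · rintro (⟨h1, h2⟩ | h)
        · exact ⟨Or.inl ⟨h1, h2.trans hF⟩, Or.inl h2⟩
        · exact ⟨Or.inr h, Or.inr (hF.trans_subset (hY x h))⟩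

/-- The join of a `k`-connected poset with the poset of proper subsets of `D` of size at
least `m`. -/
theorem conn_truncated_union {k : ℤ} {D : Finset V} {Y : Set (Finset V)} (hY : ∀ t ∈ Y, D ⊆ t)
    (hk : Conn k (chainComplex Y)) {m : ℕ} (hm : 1 ≤ m) (hmD : m ≤ D.card) :
    Conn (k + D.card - m) (chainComplex ({s | s ⊂ D ∧ m ≤ s.card} ∪ Y)) := by
  induction m, hm using Nat.le_induction with
  | base =>
    have hD : (∅ : Finset V) ⊂ D := Finset.empty_ssubset.2 (Finset.card_pos.1 hmD)
    refine (conn_openInterval_union (k := k) (D.card - 1) hD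
      (by rw [Finset.card_empty]; omega) hY hk).chain_congr (by omega) fun s => ?_
    simp only [mem_union, mem_ofPred_eq, Nat.one_le_iff_ne_zero, Finset.card_ne_zero,
      Finset.empty_ssubset]
    tauto
  | succ m hm ih =>
    have hYD : ∀ s, s ⊂ D → s ∉ Y := fun s hs hsY => hs.2 (hY s hsY)
    have h := conn_sdiff_antichain (k := k + D.card - (m + 1 : ℕ))
      (S := {s | s ⊂ D ∧ m ≤ s.card} ∪ Y) (I := {s | s ⊂ D ∧ s.card = m})
      (isAntichain_of_card_eq fun s hs => hs.2) ((ih (by omega)).mono (by omega)) ?_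
    · refine h.chain_congr rfl fun s => ?_
      simp only [mem_sdiff, mem_union, mem_ofPred_eq]
      have := hYD s
      constructor
      · rintro (⟨h1, h2⟩ | h)
        · exact ⟨Or.inl ⟨h1, by omega⟩, fun h => by omega⟩
        · exact ⟨Or.inr h, fun h' => this h'.1 h⟩
      · rintro ⟨⟨h1, h2⟩ | h, h4⟩
        · have : s.card ≠ m := fun h => h4 ⟨h1, h⟩
          exact Or.inl ⟨h1, by omega⟩
        · exact Or.inr h
    -- Nothing of size at least m lies below a set `s` of size m, so its link is the open interval
    -- from `s` to `D` together with `Y`.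
    · rintro s - ⟨hsD, hsm⟩
      refine (conn_openInterval_union (k := k) (D.card - m - 1) hsD (by omega) hY hk).chain_congr
        (by omega) fun x => ?_
      simp only [mem_union, mem_ofPred_eq]
      constructor
      · rintro ⟨⟨h1, h2⟩ | h, hlt | hlt⟩
        · have := Finset.card_lt_card hlt
          omega
        · exact Or.inl ⟨hlt, h1⟩
        · exact Or.inr h
        · exact Or.inr h
      · rintro (⟨h1, h2⟩ | h)
        · exact ⟨Or.inl ⟨h2, by have := Finset.card_lt_card h1; omega⟩, Or.inr h1⟩
        · exact ⟨Or.inr h, Or.inr (hsD.trans_subset (hY x h))⟩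

/-! ### Connectivity of X_m and of the links of its chains. -/

variable {X : PreAbstractSimplicialComplex V} {n : ℤ}

theorem link_empty : link X ∅ = X := by
  classical
  ext t
  refine ⟨fun h => ?_, fun h => ⟨face_nonempty h, Finset.disjoint_empty_left _, ?_⟩⟩
  · have := h.2.2
    rwa [Finset.empty_union] at this
  · rwa [Finset.empty_union]

theorem IsWCM.conn_supersets (hX : IsWCM X n) {s : Finset V} (hs : s ∈ X.faces) :
    Conn (n - s.card - 1) (chainComplex {t | t ∈ X.faces ∧ s ⊂ t}) := by
  have h0 := Finset.card_pos.2 (face_nonempty hs)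
  -- Here p = |s| - 1, so n - p - 2 becomes n - |s| - 1.
  refine WCM.conn_supersets ((isConnectedTo_iff_conn.1 (hX.2 (s.card - 1) s hs (by omega))).mono ?_)
  omega

theorem IsWCM.conn_simplicesAtLeast (hX : IsWCM X n) {m : ℕ} (hm : 1 ≤ m) :
    Conn (n - m) (simplicesAtLeast X m) := by
  induction m, hm using Nat.le_induction with
  | base =>
    -- The simplices properly containing ∅ are all simplices, and the link of ∅ is `X`.
    have h := WCM.conn_supersets (X := X) (σ := ∅) (k := n - 1)
      (by rw [link_empty]; exact isConnectedTo_iff_conn.1 hX.1)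
    refine h.chain_congr (by simp) fun s => ?_
    simp only [mem_ofPred_eq, Nat.one_le_iff_ne_zero, Finset.card_ne_zero, Finset.empty_ssubset]
  | succ m hm ih =>
    have h := conn_sdiff_antichain (k := n - (m + 1 : ℕ))
      (S := {s | s ∈ X.faces ∧ m ≤ s.card}) (I := {s | s.card = m})
      (isAntichain_of_card_eq fun s hs => hs) (ih.mono (by omega)) ?_
    · refine h.chain_congr rfl fun s => ?_
      simp only [mem_sdiff, mem_ofPred_eq, and_assoc]
      refine and_congr_right fun _ => ?_
      omega
    · rintro s ⟨hs, -⟩ hsm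
      refine (hX.conn_supersets hs).chain_congr
        (by rw [show s.card = m from hsm]; push_cast; ring) fun x => ?_
      simp only [mem_ofPred_eq] at hsm ⊢
      constructor
      · rintro ⟨⟨h1, h2⟩, hlt | hlt⟩
        · have := Finset.card_lt_card hlt
          omega
        · exact ⟨h1, hlt⟩
      · rintro ⟨h1, h2⟩
        exact ⟨⟨h1, by have := Finset.card_lt_card h2; omega⟩, Or.inr h2⟩

theorem exists_chain_min {c : Finset (Finset V)} (hn : c.Nonempty)
    (hc : IsChain (· ≤ ·) (c : Set (Finset V))) : ∃ s ∈ c, ∀ t ∈ c, s ⊆ t := by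
  obtain ⟨s, hs, hmin⟩ := Finset.exists_min_image c Finset.card hn
  refine ⟨s, hs, fun t ht => ?_⟩
  rcases hc.total hs ht with h | h
  · exact h
  · exact (Finset.eq_of_subset_of_card_le h (hmin t ht)).ge

/-- The upper part of the link of a chain `c` of simplices with least element `s`. -/
theorem IsWCM.conn_above (hX : IsWCM X n) (p : ℕ) : ∀ {c : Finset (Finset V)}, c.card = p + 1 →
    (∀ t ∈ c, t ∈ X.faces) → IsChain (· ≤ ·) (c : Set (Finset V)) →
    ∀ {s : Finset V}, s ∈ c → (∀ t ∈ c, s ⊆ t) → Conn (n - s.card - 1 - p)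
      (chainComplex {t | t ∈ X.faces ∧ s ⊂ t ∧ t ∉ c ∧ ∀ r ∈ c, t ⊆ r ∨ r ⊆ t}) := by
  classical
  induction p with
  | zero =>
    intro c hcard hcX hc s hs hmin
    obtain ⟨r, rfl⟩ := Finset.card_eq_one.1 hcard
    rw [Finset.mem_singleton] at hs
    subst hs
    refine (hX.conn_supersets (hcX s (by simp))).chain_congr (by simp) fun t => ?_
    simp only [mem_ofPred_eq, Finset.mem_singleton, forall_eq]
    exact ⟨fun h => ⟨h.1, h.2.1⟩, fun h => ⟨h.1, h.2, h.2.ne', Or.inr h.2.1⟩⟩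
  | succ p ih =>
    intro c hcard hcX hc s hs hmin
    have hcard' : (c.erase s).card = p + 1 := by
      rw [Finset.card_erase_of_mem hs, hcard]; rfl
    have hc' : IsChain (· ≤ ·) ((c.erase s : Finset (Finset V)) : Set (Finset V)) :=
      hc.mono (Finset.coe_subset.2 (Finset.erase_subset _ _))
    obtain ⟨r, hr, hrmin⟩ := exists_chain_min (Finset.card_pos.1 (by omega)) hc'
    have hrc := Finset.mem_of_mem_erase hr
    have hsr : s ⊂ r := (hmin r hrc).ssubset_of_ne (Finset.ne_of_mem_erase hr).symm
    have hlt := Finset.card_lt_card hsr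
    -- Above `s`, the elements comparable with the chain lie strictly between `s` and the next
    -- member `r`, or above `r`. The interval contributes |r| - |s| - 1, so |r| cancels.
    refine (conn_openInterval_union (r.card - s.card - 1) hsr (by omega) (fun t ht => ht.2.1.1)
      (ih hcard' (fun t ht => hcX t (Finset.mem_of_mem_erase ht)) hc' hr hrmin)).chain_congr
      (by push_cast; omega) fun t => ?_
    simp only [mem_union, mem_ofPred_eq]
    constructor
    · rintro ⟨h1, h2, h3, h4⟩
      rcases h4 r hrc with h | h
      · exact Or.inl ⟨h2, h.ssubset_of_ne fun h' => h3 (h' ▸ hrc)⟩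
      · exact Or.inr ⟨h1, h.ssubset_of_ne fun h' => h3 (h' ▸ hrc),
          fun h' => h3 (Finset.mem_of_mem_erase h'), fun q hq => h4 q (Finset.mem_of_mem_erase hq)⟩
    · rintro (⟨h1, h2⟩ | ⟨h1, h2, h3, h4⟩)
      · refine ⟨face_mono (hcX r hrc) h2.1 ((Finset.empty_ssubset.1
          ((Finset.empty_subset s).trans_ssubset h1))), h1, fun h => ?_, fun q hq => ?_⟩
        · exact h2.2 (hrmin t (Finset.mem_erase.2 ⟨h1.ne', h⟩))
        · by_cases hqs : q = s
          · exact Or.inr (hqs ▸ h1.1)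
          · exact Or.inl (h2.1.trans (hrmin q (Finset.mem_erase.2 ⟨hqs, hq⟩)))
      · refine ⟨h1, hsr.trans h2, fun h => h3 (Finset.mem_erase.2 ⟨(hsr.trans h2).ne', h⟩),
          fun q hq => ?_⟩
        by_cases hqs : q = s
        · exact Or.inr (hqs ▸ (hsr.trans h2).1)
        · exact h4 q (Finset.mem_erase.2 ⟨hqs, hq⟩)

end

end WCM

theorem lemma3p1 {V : Type*} (X : PreAbstractSimplicialComplex V) (n : ℤ) (m : ℕ) (hm : 1 ≤ m)
    (hX : WCM.IsWCM X n) :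
    WCM.IsWCM (WCM.simplicesAtLeast X m) (n - m + 1) := by
  refine ⟨WCM.isConnectedTo_iff_conn.2 ((hX.conn_simplicesAtLeast hm).mono (by omega)),
    fun p c hc hcard => WCM.isConnectedTo_iff_conn.2 ?_⟩
  obtain ⟨hn, hcS, hch⟩ := id hc
  obtain ⟨s, hs, hmin⟩ := WCM.exists_chain_min hn hch
  -- The link of `c` consists of the part below its least element `s` and the part above. The
  -- connectivity is (n - |s| - 1 - p) + |s| - m, which is (n - m + 1) - p - 2.
  have h := WCM.conn_truncated_union (D := s) (fun t ht => ht.2.1.1)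
    (hX.conn_above p hcard (fun t ht => (hcS ht).1) hch hs hmin) hm (hcS hs).2
  rw [WCM.simplicesAtLeast, WCM.link_chainComplex hc]
  refine h.chain_congr (by ring) fun t => ?_
  simp only [Set.mem_union, Set.mem_ofPred_eq]
  constructor
  · rintro ⟨⟨h1, h2⟩, h3, h4⟩
    rcases h4 s hs with h | h
    · exact Or.inl ⟨h.ssubset_of_ne fun h' => h3 (h' ▸ hs), h2⟩
    · exact Or.inr ⟨h1, h.ssubset_of_ne fun h' => h3 (h' ▸ hs), h3, h4⟩
  · rintro (⟨h1, h2⟩ | ⟨h1, h2, h3, h4⟩)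
    · exact ⟨⟨WCM.face_mono (hcS hs).1 h1.1 (Finset.card_pos.1 (by omega)), h2⟩,
        fun h => h1.2 (hmin t h), fun q hq => Or.inl (h1.1.trans (hmin q hq))⟩
    · exact ⟨⟨h1, (hcS hs).2.trans (Finset.card_le_card h2.1)⟩, h3, h4⟩
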